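/- **Setting.** Requests $\langle \mathrm{Insert}, name, w\rangle$ (integer length $w\ge 1$, name not in use) and $\langle\mathrm{Delete}, name\rangle$ (of an active object) arrive online, starting from an empty array. An object is active from the start of the request that inserts it until the request that deletes it has been completed. $V$ is the total length and $\Delta$ the largest length of the objects active at the moment considered. Fix $0<\varepsilon'\le 1/2$. **Data structure.** Size class $i$ consists of the lengths $w$ with $2^{i-1}\le w<2^i$. The array is a sequence of regions, one for each class up to the largest class of an active object, in increasing order; region $i$ is a payload segment of some size $P(i)$ holding only objects of class $i$, followed by a buffer segment of size $\lfloor\varepsilon' P(i)\rfloor$. *Insert* of an object of class $i$: if $i$ is larger than all existing classes, a new last region with the object as its payload ($P(i)=w$) is created (classes in between get empty regions). Otherwise the object is put at the end of the contents of the earliest buffer $j\ge i$ that has $w$ unoccupied cells; if there is none, it is put at the end of the contents of the last buffer, exceeding its capacity, and a flush is triggered. *Delete* of an object of class $i$: its space becomes a hole that stays occupied until the next flush of the segment containing it, and a dummy delete record of size $w$ is put into the earliest buffer $j\ge i$ with $w$ unoccupied cells; if there is none, a flush is triggered (without a record). *Flush.* Let $b$ be the largest class such that the triggering object and all objects with an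 insertion or a delete record in a buffer $i\ge b$ belong to classes $\ge b$. After the flush, for each $i\ge b$ the payload segment of class $i$ contains exactly the remaining objects of class $i$ without gaps (those that were in the payload, followed by the buffered ones), so $P(i)$ is their volume, and the buffer of class $i$ is empty, of size $\lfloor\varepsilon' P(i)\rfloor$; the regions of classes $<b$ are unchanged, and empty regions at the end disappear. Let $w$ be the size of the triggering insertion ($w=0$ for a deletion), $L$ the end of the contents of the last buffer before the triggering request, $L'$ the space of the data structure after the flush minus $w$, $B$ the total size of the buffers $i\ge b$ before the flush, and $M=\max\{L,L'\}+B+\Delta$. (1) All objects in buffers $i\ge b$ (including the newly inserted one), in any order, are moved to consecutive locations starting at $M$. (2) The payload objects of classes $\ge b$, from the last to the first, are moved so that they end up contiguous and ending at $M$; this happens in phases, each moving as many objects as possible of total volume at most $B+\Delta$. (3) The same objects, from the first to the last, are moved to their final locations, in phases that each fill a stretch of at most $B+\Delta$ cells. (4) The buffered objects are moved to their final locations. Each of (1), (4), and every phase of (2) and (3), is followed by a checkpoint; the old location of a moved object remains occupied until the next checkpoint. The *footprint* at a moment is the end of the used part of the array, where all segments (including their unoccupied cells; during a flush, both the old and the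 new segments), all stored objects, and all copies freed since the last checkpoint count as used. **Lemma.** There is an absolute constant $C>0$ such that for every $0<\varepsilon'\le 1/2$ and every sequence of requests as above, at every moment of the processing of every request, including every moment in the middle of a flush, the footprint is at most $(1+C\varepsilon')V+\Delta$. -/

import Mathlib

namespace Realloc

/-! ### Requests, active objects -/

/-- An object with its name and its (integral) length. -/
structure Obj where
  name : ℕ
  size : ℕ
deriving DecidableEq

/-- An online request. -/
inductive Request where
  | insert (name length : ℕ)
  | delete (name : ℕ)

/-- The active objects once a request has been completed. -/
def activeStep (A : List Obj) : Request → List Obj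
  | .insert n w => A ++ [⟨n, w⟩]
  | .delete n => A.filter (fun o => o.name ≠ n)

/-- A request makes sense if it inserts an object of positive length under a name that is not in
use, or deletes an active object. -/
def Request.Admissible (A : List Obj) : Request → Prop
  | .insert n w => 1 ≤ w ∧ ∀ o ∈ A, o.name ≠ n
  | .delete n => ∃ o ∈ A, o.name = n

/-- A sequence of requests makes sense when `A` is the list of active objects at its start. -/
def Admissible : List Obj → List Request → Prop
  | _, [] => True
  | A, q :: qs => q.Admissible A ∧ Admissible (activeStep A q) qs

/-- Total length of a list of objects. -/
def volume (A : List Obj) : ℕ := (A.map Obj.size).sum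

/-- Length of the longest object of a list (`0` for the empty list). -/
def longest (A : List Obj) : ℕ := (A.map Obj.size).foldr max 0

/-- Size class `i` consists of the lengths `w` with `2 ^ i ≤ w < 2 ^ (i + 1)`;
classes are counted from `0`. -/
def sizeClass (w : ℕ) : ℕ := Nat.log 2 w

/-! ### Segments, regions, and the layout of the array -/

/-- What a stretch of a segment is used for: an object that is stored there, the hole left by an
object that has been deleted since, or a dummy delete record for an object (which takes as much
space as the object).  Delete records occur in buffer segments only. -/
inductive Slot where
  | obj (o : Obj)
  | hole (w : ℕ)
  | record (o : Obj)

def Slot.size : Slot → ℕ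
  | .obj o => o.size
  | .hole w => w
  | .record o => o.size

/-- The object stored in a slot, if any. -/
def Slot.stored : Slot → Option Obj
  | .obj o => some o
  | .hole _ => none
  | .record _ => none

/-- The object that is the subject of a buffered insertion or deletion. -/
def Slot.subject : Slot → Option Obj
  | .obj o => some o
  | .hole _ => none
  | .record o => some o

/-- Total size of consecutive slots. -/
def slotsSize (l : List Slot) : ℕ := (l.map Slot.size).sum

/-- A region: a payload segment, completely filled by its slots, followed by a buffer segment,
filled by its slots from the left. -/
structure Region where
  payload : List Slot
  buffer : List Slot

def Region.payloadSize (r : Region) : ℕ := slotsSize r.payload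

/-- Occupied space of the buffer (holes and delete records count). -/
def Region.used (r : Region) : ℕ := slotsSize r.buffer

/-- Size `⌊ε P⌋` of the buffer segment, `P` being the size of the payload segment.  As holes stay
until the next flush of the region, `P` is the volume of the size class at its last flush. -/
noncomputable def Region.capacity (ε : ℝ) (r : Region) : ℕ := ⌊ε * (r.payloadSize : ℝ)⌋₊

/-- Space of a region. -/
noncomputable def Region.space (ε : ℝ) (r : Region) : ℕ := r.payloadSize + r.capacity ε

def Region.payloadObjs (r : Region) : List Obj := r.payload.filterMap Slot.stored

def Region.bufferObjs (r : Region) : List Obj := r.buffer.filterMap Slot.stored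

/-- The data structure between flushes: the `i`-th region (from `0`) is that of size class `i`. -/
abbrev State := List Region

/-- Space taken by all regions, i.e. the end of the last buffer segment. -/
noncomputable def space (ε : ℝ) (R : State) : ℕ := (R.map (Region.space ε)).sum

/-- A copy of an object in the array, occupying the cells `addr, …, addr + obj.size - 1`. -/
structure Block where
  obj : Obj
  addr : ℕ

/-- First cell behind a block. -/
def Block.endpoint (x : Block) : ℕ := x.addr + x.obj.size

/-- The objects stored in consecutive slots, the first of which starts at the given address. -/
def placeSlots : ℕ → List Slot → List Block
  | _, [] => []
  | a, .obj o :: l => ⟨o, a⟩ :: placeSlots (a + o.size) l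
  | a, .hole w :: l => placeSlots (a + w) l
  | a, .record o :: l => placeSlots (a + o.size) l

/-- The given objects, stored contiguously from the given address on. -/
def placeObjs (a : ℕ) (l : List Obj) : List Block := placeSlots a (l.map Slot.obj)

/-- The locations of all objects, the first region starting at the given address. -/
noncomputable def layout (ε : ℝ) : ℕ → State → List Block
  | _, [] => []
  | a, r :: R =>
      placeSlots a r.payload ++ placeSlots (a + r.payloadSize) r.buffer ++
        layout ε (a + r.space ε) R

/-! ### Buffering insertions and deletions -/

/-- Append a slot to the `j`-th buffer. -/
def appendToBuffer (j : ℕ) (s : Slot) (R : State) : State :=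
  R.modify j (fun r => { r with buffer := r.buffer ++ [s] })

/-- The earliest buffer of index at least `c` with at least `w` unoccupied cells. -/
noncomputable def findBuffer (ε : ℝ) (R : State) (c w : ℕ) : Option ℕ :=
  (List.range R.length).find? fun j =>
    decide (c ≤ j ∧ ∃ r ∈ R[j]?, r.used + w ≤ r.capacity ε)

/-- Replace the object of the given name by a hole. -/
def Slot.erase (n : ℕ) : Slot → Slot
  | .obj o => if o.name = n then .hole o.size else .obj o
  | .hole w => .hole w
  | .record o => .record o

def eraseObj (n : ℕ) (R : State) : State :=
  R.map fun r => ⟨r.payload.map (Slot.erase n), r.buffer.map (Slot.erase n)⟩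

/-! ### The buffer flush -/

/-- The elementary actions of a flush: writing a copy of an object at a new location (the old copy
is freed), and waiting for a checkpoint. -/
inductive Action where
  | move (x : Block)
  | checkpoint

/-- The boundary size class: the largest `b` such that the triggering object (of class `c`) and
all objects with an insertion or deletion in a buffer `i ≥ b` belong to classes `≥ b`. -/
def boundary (R : State) (c : ℕ) : ℕ :=
  Nat.findGreatest
    (fun b => ∀ r ∈ R.drop b, ∀ o ∈ r.buffer.filterMap Slot.subject, b ≤ sizeClass o.size) c

/-- End of the last slot in the last buffer (which may exceed the buffer's capacity). -/
noncomputable def contentEnd (ε : ℝ) (R : State) : ℕ :=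
  space ε R.dropLast + (R.getLast?.map fun r => r.payloadSize + r.used).getD 0

/-- The moves of the packing step in the given order, broken into phases of total volume as large
as possible but at most `bound`, each followed by a checkpoint.  The first argument after `bound`
is the volume already moved in the present phase. -/
def packPhases (bound : ℕ) : ℕ → List Block → List Action
  | _, [] => [.checkpoint]
  | v, x :: l =>
      if v + x.obj.size ≤ bound then .move x :: packPhases bound (v + x.obj.size) l
      else .checkpoint :: .move x :: packPhases bound x.obj.size l

/-- The moves of the unpacking step in the given order, broken into phases, each of which fills
target locations within a stretch of at most `bound` cells and is followed by a checkpoint.  The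
first argument after `bound` is the start of the present stretch. -/
def unpackPhases (bound : ℕ) : ℕ → List Block → List Action
  | _, [] => [.checkpoint]
  | a, x :: l =>
      if x.endpoint ≤ a + bound then .move x :: unpackPhases bound a l
      else .checkpoint :: .move x :: unpackPhases bound x.addr l

/-- The buffered objects of the flushed regions, in the order in which they are moved. -/
def evacuated (order : List Obj → List Obj) (b : ℕ) (R : State) : List Obj :=
  order ((R.drop b).flatMap Region.bufferObjs)

/-- The data structure after a flush of all classes `≥ b`: the payload segment of each of these
classes consists of the objects that it stored before, followed by the buffered objects of the
class, and its buffer is empty.  Empty regions at the end disappear. -/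
def flushed (order : List Obj → List Obj) (b : ℕ) (R : State) : State :=
  let newRegions : List Region := (R.drop b).mapIdx fun i r =>
    { payload := (r.payloadObjs ++
        (evacuated order b R).filter fun o => sizeClass o.size = b + i).map Slot.obj
      buffer := [] }
  (R.take b ++ newRegions).rdropWhile fun r => r.payload.isEmpty

/-- The actions of a flush of all classes `≥ b`.  Here `R` is the data structure at the start of
the flush, with a flush-triggering insertion appended to the last buffer; `w` is the size of the
inserted object (`0` if the flush is triggered by a deletion), and `Δ` is the length of the longest
active object. -/
noncomputable def flushActions (ε : ℝ) (order : List Obj → List Obj) (b : ℕ) (R : State)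
    (w Δ : ℕ) : List Action :=
  let R' := flushed order b R
  let L := contentEnd ε R - w
  let L' := space ε R' - w
  let B := ((R.drop b).map (Region.capacity ε)).sum
  let M := max L L' + B + Δ
  let buffered := evacuated order b R
  let payload := (R.drop b).flatMap Region.payloadObjs
  let target := layout ε 0 R'
  -- buffered objects go behind location `M`
  (placeObjs M buffered).map .move ++ [.checkpoint] ++
  -- payload objects are packed to the right, up to location `M`, from the last to the first
  packPhases (B + Δ) 0 (placeObjs (M - volume payload) payload).reverse ++
  -- payload objects go to their final locations, from the first to the last
  unpackPhases (B + Δ) (space ε (R.take b)) (target.filter fun x => x.obj ∈ payload) ++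
  -- buffered objects go to their final locations
  (buffered.flatMap fun o => (target.filter fun x => x.obj = o).map .move) ++ [.checkpoint]

/-! ### Executions -/

/-- The contents of the array: the current copies of the objects, and the copies freed since the
last checkpoint, whose space is not available yet. -/
structure Memory where
  live : List Block
  freed : List Block

def Memory.act (m : Memory) : Action → Memory
  | .move x =>
      ⟨m.live.filter (fun y => y.obj ≠ x.obj) ++ [x],
        m.freed ++ m.live.filter (fun y => y.obj = x.obj)⟩
  | .checkpoint => ⟨m.live, []⟩

/-- A moment of an execution: the contents of the array, the end of the last segment, and the
objects that are active at this moment. -/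
structure Moment where
  memory : Memory
  segmentsEnd : ℕ
  active : List Obj

/-- The footprint: the end of the used part of the array.  All segments (with their unoccupied
cells), all objects and all copies freed since the last checkpoint count as used. -/
def Moment.footprint (m : Moment) : ℕ :=
  max m.segmentsEnd (((m.memory.live ++ m.memory.freed).map Block.endpoint).foldr max 0)

/-- The moments of a flush of the classes `≥ b` that starts with the given memory, and the moment
of its completion.  While it proceeds, the old and the new segments are both reserved and the
objects in `A` are active; at the end, those in `A'` are. -/
noncomputable def flushMoments (ε : ℝ) (order : List Obj → List Obj) (b : ℕ) (R : State)
    (w : ℕ) (start : Memory) (A A' : List Obj) : List Moment :=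
  let R' := flushed order b R
  let mems := (flushActions ε order b R w (longest A)).scanl Memory.act start
  mems.map (fun μ => ⟨μ, max (space ε R) (space ε R'), A⟩) ++
    [⟨mems.getLastD start, space ε R', A'⟩]

/-- Insertion of an object: the moments of the request, and the resulting data structure. The
object is active from the start. `A` holds the objects active before the request. -/
noncomputable def insertObj (ε : ℝ) (order : List Obj → List Obj) (R : State) (A : List Obj)
    (o : Obj) : List Moment × State :=
  let c := sizeClass o.size
  let A' := A ++ [o]
  if R.length ≤ c then
    -- the object is in a larger class than all others: new regions at the end
    let R₁ := R ++ List.replicate (c - R.length) ⟨[], []⟩ ++ [⟨[.obj o], []⟩]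
    ([⟨⟨layout ε 0 R₁, []⟩, space ε R₁, A'⟩], R₁)
  else
    match findBuffer ε R c o.size with
    | some j =>
        let R₁ := appendToBuffer j (.obj o) R
        ([⟨⟨layout ε 0 R₁, []⟩, space ε R₁, A'⟩], R₁)
    | none =>
        let R₁ := appendToBuffer (R.length - 1) (.obj o) R
        let b := boundary R₁ c
        (flushMoments ε order b R₁ o.size ⟨layout ε 0 R₁, []⟩ A' A', flushed order b R₁)

/-- Deletion of an object: the moments of the request, and the resulting data structure. The
object is active until the request is completed. -/
noncomputable def deleteObj (ε : ℝ) (order : List Obj → List Obj) (R : State) (A : List Obj)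
    (o : Obj) : List Moment × State :=
  let c := sizeClass o.size
  let A' := A.filter (fun p => p.name ≠ o.name)
  let R₁ := eraseObj o.name R
  let old := (layout ε 0 R).filter fun x => x.obj.name = o.name
  match findBuffer ε R₁ c o.size with
  | some j =>
      let R₂ := appendToBuffer j (.record o) R₁
      ([⟨⟨layout ε 0 R, []⟩, space ε R, A⟩, ⟨⟨layout ε 0 R₂, old⟩, space ε R₂, A'⟩], R₂)
  | none =>
      let b := boundary R₁ c
      (⟨⟨layout ε 0 R, []⟩, space ε R, A⟩ ::
        flushMoments ε order b R₁ 0 ⟨layout ε 0 R₁, old⟩ A A', flushed order b R₁)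

/-- Processing one request (a deletion of an object that is not there does nothing). -/
noncomputable def process (ε : ℝ) (order : List Obj → List Obj) (R : State) (A : List Obj) :
    Request → List Moment × State
  | .insert n w => insertObj ε order R A ⟨n, w⟩
  | .delete n =>
      match A.find? (fun o => o.name = n) with
      | some o => deleteObj ε order R A o
      | none => ([], R)

/-- All moments of the processing of a sequence of requests, from a given data structure and given
active objects on. -/
noncomputable def execution (ε : ℝ) (order : List Obj → List Obj) :
    State → List Obj → List Request → List Moment
  | _, _, [] => []
  | R, A, q :: qs =>
      (process ε order R A q).1 ++
        execution ε order (process ε order R A q).2 (activeStep A q) qs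

end Realloc

/-! The only waste between flushes consists of buffers and of holes in payload segments, and both
are charged to the buffers. Each hole in the payload of class i is paid for by a delete record of
class i lying in some buffer, and no buffer is overfull. With P the total payload size this gives P
≤ V + εP, hence (1 - ε)P ≤ V (`Inv.totalPayload_le`). For ε ≤ 1/2 all segments then take at most (1
+ 4ε)V cells and the buffers at most 2εV.

During a flush every copy is either an initial one or the target of a move
(`mem_memory_of_mem_scanl`), so order, phases and checkpoints do not affect the bound. The rightmost
target is the end of the evacuated objects, M plus their volume, which is at most B + w. The w
subtracted inside M cancels this w, so the total is at most max(S + w, S') + 2B + Δ, with S and S'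
the space before and after. Both alternatives are at most (1 + 8ε)V + Δ; this is where C = 8 comes
from (`flush_bounded`).

It remains to preserve the invariant. A triggering request violates it temporarily: an insertion
overfills the last buffer, a deletion leaves a hole without a record. Both defects lie in regions of
index at least the boundary b, which the flush rebuilds; hence the parameter `k` of `Inv`, set to b
at that point. By the choice of b, the flushed buffers contain no records for classes below b, so
the holes that remain there stay paid for (`recordVolume_drop_eq_zero`, `Inv.flushed`).

The moment of completion needs its own argument, since only the new segments count then: no
temporary copy may survive (`final_endpoint_le`). -/

namespace Realloc

/-! ### Volumes of lists of objects -/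

@[simp] theorem volume_nil : volume [] = 0 := rfl

@[simp] theorem volume_cons (o : Obj) (l : List Obj) : volume (o :: l) = o.size + volume l := by
  simp [volume]

@[simp] theorem volume_append (l l' : List Obj) : volume (l ++ l') = volume l + volume l' := by
  simp [volume]

theorem volume_perm {l l' : List Obj} (h : l.Perm l') : volume l = volume l' :=
  (h.map _).sum_eq

theorem volume_sublist {l l' : List Obj} (h : l.Sublist l') : volume l ≤ volume l' :=
  (h.map _).sum_le_sum (by simp)

theorem volume_filter_add (p : Obj → Bool) (l : List Obj) :
    volume (l.filter p) + volume (l.filter fun o => !p o) = volume l := by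
  rw [← volume_append]
  exact volume_perm (List.filter_append_perm p l)

theorem size_le_volume {o : Obj} {l : List Obj} (h : o ∈ l) : o.size ≤ volume l := by
  simpa using volume_sublist (List.singleton_sublist.2 h)

theorem volume_flatMap {α : Type*} (f : α → List Obj) (l : List α) :
    volume (l.flatMap f) = (l.map fun a => volume (f a)).sum := by
  induction l with
  | nil => rfl
  | cons a l ih => simp [ih]

/-- The parts of a list in finitely many size classes have total volume at most that of the
list. -/
theorem sum_volume_class_le (n : ℕ) (l : List Obj) :
    ∑ i ∈ Finset.range n, volume (l.filter fun o => sizeClass o.size = i) ≤ volume l := by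
  induction l with
  | nil => simp
  | cons o l ih =>
    have h : ∀ i, volume ((o :: l).filter fun o => sizeClass o.size = i) =
        (if sizeClass o.size = i then o.size else 0) +
          volume (l.filter fun o => sizeClass o.size = i) := by
      intro i
      by_cases hi : sizeClass o.size = i <;> simp [hi]
    simp only [h, Finset.sum_add_distrib, Finset.sum_ite_eq, volume_cons]
    split_ifs <;> omega

/-! ### Sums and concatenations over the regions, and changes to a single region -/

theorem sum_map_le_of_getElem? {α : Type*} (g h : α → ℕ) (R : List α) :
    ∀ f : ℕ → ℕ, (∀ i r, R[i]? = some r → g r ≤ h r + f i) →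
      (R.map g).sum ≤ (R.map h).sum + ∑ i ∈ Finset.range R.length, f i := by
  induction R with
  | nil => simp
  | cons r R ih =>
    intro f hf
    have h1 := ih (fun i => f (i + 1)) (fun i s hs => hf (i + 1) s (by simpa using hs))
    have h2 := hf 0 r (by simp)
    simp only [List.map_cons, List.sum_cons, List.length_cons, Finset.sum_range_succ']
    omega

/-- At most one summand changes, and none if the modified entry is dropped. Needed for the contents
of the flushed buffers after an overfull insertion. -/
theorem sum_map_modify_le {α : Type*} (g : α → ℕ) (f : α → α) (w : ℕ)
    (hf : ∀ a, g (f a) ≤ g a + w) (R : List α) (j b : ℕ) :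
    (((R.modify j f).drop b).map g).sum ≤ ((R.drop b).map g).sum + w := by
  induction R generalizing j b with
  | nil => simp
  | cons r R ih =>
    cases j <;> cases b
    · have := hf r
      simp; omega
    · simp
    · have := ih ‹_› 0
      simp at this ⊢; omega
    · simpa using ih _ _

theorem map_modify_eq {α β : Type*} (g : α → β) (f : α → α) (hf : ∀ a, g (f a) = g a)
    (R : List α) (j : ℕ) : (R.modify j f).map g = R.map g := by
  induction R generalizing j with
  | nil => simp
  | cons r R ih => cases j <;> simp [hf, ih]

theorem flatMap_modify_perm {α β : Type*} (g : α → List β) (f : α → α) (x : List β)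
    (hf : ∀ a, (g (f a)).Perm (g a ++ x)) (R : List α) (j : ℕ) (hj : j < R.length) :
    ((R.modify j f).flatMap g).Perm (R.flatMap g ++ x) := by
  induction R generalizing j with
  | nil => simp at hj
  | cons r R ih =>
    cases j with
    | zero =>
      simp only [List.modify_zero_cons, List.flatMap_cons]
      refine ((hf r).append_right _).trans ?_
      rw [List.append_assoc, List.append_assoc]
      exact List.perm_append_comm.append_left _
    | succ j =>
      simp only [List.modify_succ_cons, List.flatMap_cons, List.append_assoc]
      exact (ih j (by simpa using hj)).append_left _

/-! ### Objects and delete records of a data structure -/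

/-- The object that a delete record refers to. -/
def Slot.recorded : Slot → Option Obj
  | .obj _ => none
  | .hole _ => none
  | .record o => some o

/-- The objects stored in a region. -/
def Region.objs (r : Region) : List Obj := r.payloadObjs ++ r.bufferObjs

/-- The objects with a delete record in the buffer of a region. -/
def Region.records (r : Region) : List Obj := r.buffer.filterMap Slot.recorded

/-- All objects stored in the data structure. -/
def storedObjs (R : State) : List Obj := R.flatMap Region.objs

/-- The objects with a delete record in some buffer. -/
def recordedObjs (R : State) : List Obj := R.flatMap Region.records

/-- Total volume of the delete records for objects of class `i`. -/
def recordVolume (R : State) (i : ℕ) : ℕ :=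
  volume ((recordedObjs R).filter fun o => sizeClass o.size = i)

theorem recordVolume_append (R S : State) (i : ℕ) :
    recordVolume (R ++ S) i = recordVolume R i + recordVolume S i := by
  simp [recordVolume, recordedObjs]

theorem volume_stored_le (l : List Slot) : volume (l.filterMap Slot.stored) ≤ slotsSize l := by
  induction l with
  | nil => simp [slotsSize]
  | cons s l ih =>
    simp only [slotsSize] at ih ⊢
    cases s <;> simp [List.filterMap_cons, Slot.stored, Slot.size] <;> omega

/-- Each slot contributes to at most one of the two volumes; holes account for the slack. -/
theorem volume_stored_add_recorded_le (l : List Slot) :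
    volume (l.filterMap Slot.stored) + volume (l.filterMap Slot.recorded) ≤ slotsSize l := by
  induction l with
  | nil => simp [slotsSize]
  | cons s l ih =>
    simp only [slotsSize] at ih ⊢
    cases s <;> simp [List.filterMap_cons, Slot.stored, Slot.recorded, Slot.size] <;> omega

theorem filterMap_stored_map_obj (l : List Obj) : (l.map Slot.obj).filterMap Slot.stored = l := by
  induction l with
  | nil => rfl
  | cons o l ih => simp [Slot.stored, ih]

theorem slotsSize_map_obj (l : List Obj) : slotsSize (l.map Slot.obj) = volume l := by
  simp [slotsSize, volume, Function.comp_def, Slot.size]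

theorem subject_of_stored {l : List Slot} {o : Obj} (h : o ∈ l.filterMap Slot.stored) :
    o ∈ l.filterMap Slot.subject := by
  simp only [List.mem_filterMap] at h ⊢
  obtain ⟨s, hs, h⟩ := h
  exact ⟨s, hs, by cases s <;> simp_all [Slot.stored, Slot.subject]⟩

theorem subject_of_recorded {l : List Slot} {o : Obj} (h : o ∈ l.filterMap Slot.recorded) :
    o ∈ l.filterMap Slot.subject := by
  simp only [List.mem_filterMap] at h ⊢
  obtain ⟨s, hs, h⟩ := h
  exact ⟨s, hs, by cases s <;> simp_all [Slot.recorded, Slot.subject]⟩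

theorem mem_storedObjs_of_buffer {R : State} {r : Region} {o : Obj} (hr : r ∈ R)
    (h : o ∈ r.bufferObjs) : o ∈ storedObjs R :=
  List.mem_flatMap.2 ⟨r, hr, List.mem_append_right _ h⟩

/-- Total size of the payload segments. -/
def totalPayload (R : State) : ℕ := (R.map Region.payloadSize).sum

theorem capacity_le {ε : ℝ} (hε : 0 < ε) (r : Region) :
    (r.capacity ε : ℝ) ≤ ε * r.payloadSize :=
  Nat.floor_le (by positivity)

theorem sum_capacity_le {ε : ℝ} (hε : 0 < ε) (R : State) :
    ((R.map (Region.capacity ε)).sum : ℝ) ≤ ε * totalPayload R := by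
  induction R with
  | nil => simp [totalPayload]
  | cons r R ih =>
    have := capacity_le hε r
    simp only [totalPayload, List.map_cons, List.sum_cons, Nat.cast_add] at ih ⊢
    linarith

theorem space_eq (ε : ℝ) (R : State) :
    space ε R = totalPayload R + (R.map (Region.capacity ε)).sum := by
  induction R with
  | nil => rfl
  | cons r R ih =>
    simp only [space, totalPayload, List.map_cons, List.sum_cons, Region.space] at ih ⊢
    omega

@[simp] theorem space_append (ε : ℝ) (R S : State) :
    space ε (R ++ S) = space ε R + space ε S := by
  simp [space]

theorem sum_capacity_drop_le (ε : ℝ) (R : State) (b : ℕ) :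
    ((R.drop b).map (Region.capacity ε)).sum ≤ (R.map (Region.capacity ε)).sum :=
  ((List.drop_sublist b R).map _).sum_le_sum (by simp)

/-! ### The invariant -/

/-- The data structure `R` stores exactly the active objects `A`, in regions and buffers that fit
their size classes.  In the first `k` regions, buffers are not overfull, and the holes in a payload
segment are accounted for by delete records for objects of its class. -/
structure Inv (ε : ℝ) (k : ℕ) (A : List Obj) (R : State) : Prop where
  perm : (storedObjs R).Perm A
  names : (A.map Obj.name).Nodup
  pos : ∀ o ∈ A, 1 ≤ o.size
  payload_class : ∀ i r, R[i]? = some r → ∀ o ∈ r.payloadObjs, sizeClass o.size = i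
  buffer_class : ∀ i r, R[i]? = some r →
    ∀ o ∈ r.buffer.filterMap Slot.subject, sizeClass o.size ≤ i
  used_le : ∀ i r, i < k → R[i]? = some r → r.used ≤ r.capacity ε
  payload_le : ∀ i r, i < k → R[i]? = some r →
    r.payloadSize ≤ volume r.payloadObjs + recordVolume R i

theorem Inv.used_le_of_mem {ε : ℝ} {A : List Obj} {R : State} (h : Inv ε R.length A R)
    {r : Region} (hr : r ∈ R) : r.used ≤ r.capacity ε := by
  obtain ⟨i, hi, rfl⟩ := List.mem_iff_getElem.1 hr
  exact h.used_le i _ hi (by simp [hi])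

/-- Holes are bounded by delete records of the same class. Summed over all classes, these records
fit into the buffers, whose capacity is at most ε times the payload; this term is absorbed on the
left. -/
theorem Inv.totalPayload_le {ε : ℝ} (hε : 0 < ε) {A : List Obj} {R : State}
    (h : Inv ε R.length A R) : (1 - ε) * totalPayload R ≤ volume A := by
  have h1 : totalPayload R ≤ (R.map fun r => volume r.payloadObjs).sum +
      ∑ i ∈ Finset.range R.length, recordVolume R i := by
    refine sum_map_le_of_getElem? _ _ R _ fun i r hr => h.payload_le i r ?_ hr
    by_contra hi
    simp [List.getElem?_eq_none (not_lt.1 hi)] at hr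
  have h2 : ∑ i ∈ Finset.range R.length, recordVolume R i ≤ volume (recordedObjs R) :=
    sum_volume_class_le _ _
  have h3 : volume (recordedObjs R) ≤ (R.map (Region.capacity ε)).sum := by
    rw [recordedObjs, volume_flatMap]
    refine List.sum_le_sum fun r hr => ?_
    have := volume_stored_add_recorded_le r.buffer
    have := h.used_le_of_mem hr
    simp only [Region.used, Region.records] at *
    omega
  have h4 : (R.map fun r => volume r.payloadObjs).sum ≤ volume A := by
    rw [← volume_perm h.perm, storedObjs, volume_flatMap]
    exact List.sum_le_sum fun r _ => by simp [Region.objs]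
  have h5 := sum_capacity_le hε R
  have h6 : (totalPayload R : ℝ) ≤ volume A + (R.map (Region.capacity ε)).sum := by
    exact_mod_cast (by omega : totalPayload R ≤ volume A + (R.map (Region.capacity ε)).sum)
  linarith

/-- A flush uses the buffer capacity twice more: once inside M, once for the evacuated objects
behind M. The left side is at most (1 + 3ε)P, and (1 + 8ε)(1 - ε) ≥ 1 + 3ε exactly because ε ≤ 1/2.
-/
theorem Inv.space_add_le {ε : ℝ} (hε : 0 < ε) (hε' : ε ≤ 1 / 2) {A : List Obj} {R : State}
    (h : Inv ε R.length A R) :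
    (space ε R : ℝ) + 2 * (R.map (Region.capacity ε)).sum ≤ (1 + 8 * ε) * volume A := by
  have h1 := h.totalPayload_le hε
  have h2 := sum_capacity_le hε R
  have h3 : (0 : ℝ) ≤ totalPayload R := by positivity
  rw [space_eq, Nat.cast_add]
  nlinarith [mul_nonneg (mul_nonneg hε.le (sub_nonneg.2 hε')) h3,
    mul_le_mul_of_nonneg_left h1 (by positivity : 0 ≤ 1 + 8 * ε)]

/-- Here (1 + 4ε)(1 - ε) ≥ 1 + ε, again by ε ≤ 1/2. The smaller constant leaves 4ε for two buffer
terms of 2ε each when the new layout is the longer one in a flush. -/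
theorem Inv.space_le {ε : ℝ} (hε : 0 < ε) (hε' : ε ≤ 1 / 2) {A : List Obj} {R : State}
    (h : Inv ε R.length A R) : (space ε R : ℝ) ≤ (1 + 4 * ε) * volume A := by
  have h1 := h.totalPayload_le hε
  have h2 := sum_capacity_le hε R
  have h3 : (0 : ℝ) ≤ totalPayload R := by positivity
  rw [space_eq, Nat.cast_add]
  nlinarith [mul_nonneg (mul_nonneg hε.le (sub_nonneg.2 hε')) h3,
    mul_le_mul_of_nonneg_left h1 (by positivity : 0 ≤ 1 + 4 * ε)]

theorem Inv.capacity_le {ε : ℝ} (hε : 0 < ε) (hε' : ε ≤ 1 / 2) {A : List Obj} {R : State}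
    (h : Inv ε R.length A R) :
    ((R.map (Region.capacity ε)).sum : ℝ) ≤ 2 * ε * volume A := by
  have h1 := h.totalPayload_le hε
  have h2 := sum_capacity_le hε R
  have h3 : (0 : ℝ) ≤ totalPayload R := by positivity
  nlinarith [mul_nonneg (mul_nonneg hε.le (sub_nonneg.2 hε')) h3,
    mul_le_mul_of_nonneg_left h1 hε.le]

theorem inv_nil (ε : ℝ) : Inv ε 0 [] [] := by
  constructor <;> simp [storedObjs]

/-! ### Buffering requests -/

theorem getElem?_appendToBuffer {R : State} {j i : ℕ} {s : Slot} {r : Region}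
    (h : (appendToBuffer j s R)[i]? = some r) :
    ∃ r₀, R[i]? = some r₀ ∧ r.payload = r₀.payload ∧
      r.buffer = r₀.buffer ++ if j = i then [s] else [] := by
  simp only [appendToBuffer, List.getElem?_modify, Option.map_eq_map, Option.map_eq_some_iff] at h
  obtain ⟨r₀, h0, rfl⟩ := h
  refine ⟨r₀, h0, ?_⟩
  split_ifs <;> simp

@[simp] theorem length_appendToBuffer (j : ℕ) (s : Slot) (R : State) :
    (appendToBuffer j s R).length = R.length := by
  simp [appendToBuffer]

theorem space_appendToBuffer (ε : ℝ) (j : ℕ) (s : Slot) (R : State) :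
    space ε (appendToBuffer j s R) = space ε R := by
  rw [space, appendToBuffer, map_modify_eq, space]
  exact fun _ => rfl

theorem map_capacity_appendToBuffer (ε : ℝ) (j : ℕ) (s : Slot) (R : State) :
    (appendToBuffer j s R).map (Region.capacity ε) = R.map (Region.capacity ε) := by
  rw [appendToBuffer, map_modify_eq]
  exact fun _ => rfl

theorem findBuffer_some {ε : ℝ} {R : State} {c w j : ℕ} (h : findBuffer ε R c w = some j) :
    c ≤ j ∧ ∃ r, R[j]? = some r ∧ r.used + w ≤ r.capacity ε := by
  have := List.find?_some h
  simpa using this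

theorem recordVolume_appendToBuffer_obj (j : ℕ) (o : Obj) (R : State) (i : ℕ) :
    recordVolume (appendToBuffer j (.obj o) R) i = recordVolume R i := by
  rw [recordVolume, recordedObjs, appendToBuffer, List.flatMap_def, map_modify_eq]
  · rfl
  · simp [Region.records, Slot.recorded]

theorem recordVolume_appendToBuffer_record {j : ℕ} (o : Obj) {R : State} (hj : j < R.length)
    (i : ℕ) : recordVolume (appendToBuffer j (.record o) R) i =
      recordVolume R i + if sizeClass o.size = i then o.size else 0 := by
  have h : (recordedObjs (appendToBuffer j (.record o) R)).Perm (recordedObjs R ++ [o]) :=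
    flatMap_modify_perm _ _ _ (fun r => by simp [Region.records, Slot.recorded]) _ _ hj
  rw [recordVolume, volume_perm (h.filter _), List.filter_append, volume_append, recordVolume]
  by_cases hc : sizeClass o.size = i <;> simp [hc]

theorem names_append {A : List Obj} {o : Obj} (hA : (A.map Obj.name).Nodup)
    (ho : ∀ p ∈ A, p.name ≠ o.name) : ((A ++ [o]).map Obj.name).Nodup := by
  rw [List.map_append, List.nodup_append]
  refine ⟨hA, by simp, ?_⟩
  simpa using ho

/-- Buffering an insertion, possibly beyond the capacity of the buffer. -/
theorem Inv.append_obj {ε : ℝ} {k k' : ℕ} {A : List Obj} {R : State} (h : Inv ε k A R) {o : Obj}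
    (hpos : 1 ≤ o.size) (hname : ∀ p ∈ A, p.name ≠ o.name) {j : ℕ} (hj : j < R.length)
    (hc : sizeClass o.size ≤ j) (hk : k' ≤ k)
    (hfit : j < k' → ∀ r, R[j]? = some r → r.used + o.size ≤ r.capacity ε) :
    Inv ε k' (A ++ [o]) (appendToBuffer j (.obj o) R) where
  perm := by
    refine (flatMap_modify_perm _ _ [o] (fun r => ?_) _ _ hj).trans (h.perm.append_right _)
    simp [Region.objs, Region.payloadObjs, Region.bufferObjs, Slot.stored]
  names := names_append h.names hname
  pos := by
    simp only [List.mem_append, List.mem_singleton]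
    rintro p (hp | rfl)
    exacts [h.pos p hp, hpos]
  payload_class i r hr := by
    obtain ⟨r₀, h0, hp, -⟩ := getElem?_appendToBuffer hr
    simpa [Region.payloadObjs, hp] using h.payload_class i r₀ h0
  buffer_class i r hr p hp := by
    obtain ⟨r₀, h0, -, hb⟩ := getElem?_appendToBuffer hr
    rw [hb, List.filterMap_append, List.mem_append] at hp
    rcases hp with hp | hp
    · exact h.buffer_class i r₀ h0 p hp
    · split_ifs at hp with hji
      · simp [Slot.subject] at hp
        subst hp hji
        exact hc
      · simp at hp
  used_le i r hi hr := by
    obtain ⟨r₀, h0, hp, hb⟩ := getElem?_appendToBuffer hr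
    have e : r.capacity ε = r₀.capacity ε := by simp [Region.capacity, Region.payloadSize, hp]
    rw [e, Region.used, hb]
    split_ifs with hji
    · subst hji
      simpa [slotsSize, Slot.size, Region.used] using hfit hi r₀ h0
    · simpa [Region.used] using h.used_le i r₀ (by omega) h0
  payload_le i r hi hr := by
    obtain ⟨r₀, h0, hp, -⟩ := getElem?_appendToBuffer hr
    rw [recordVolume_appendToBuffer_obj]
    simpa [Region.payloadObjs, Region.payloadSize, hp] using h.payload_le i r₀ (by omega) h0

/-! ### Deletions -/

theorem filterMap_stored_erase (n : ℕ) (l : List Slot) :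
    (l.map (Slot.erase n)).filterMap Slot.stored =
      (l.filterMap Slot.stored).filter fun o => o.name ≠ n := by
  induction l with
  | nil => rfl
  | cons s l ih =>
    cases s with
    | obj o => by_cases h : o.name = n <;> simp_all [List.filterMap_cons, Slot.erase, Slot.stored]
    | hole w => simp_all [List.filterMap_cons, Slot.erase, Slot.stored]
    | record o => simp_all [List.filterMap_cons, Slot.erase, Slot.stored]

theorem Slot.size_erase (n : ℕ) (s : Slot) : (s.erase n).size = s.size := by
  cases s with
  | obj o => by_cases h : o.name = n <;> simp [Slot.erase, h, Slot.size]
  | hole w => rfl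
  | record o => rfl

theorem slotsSize_erase (n : ℕ) (l : List Slot) :
    slotsSize (l.map (Slot.erase n)) = slotsSize l := by
  simp [slotsSize, Function.comp_def, Slot.size_erase]

theorem subject_of_erase {n : ℕ} {l : List Slot} {o : Obj}
    (h : o ∈ (l.map (Slot.erase n)).filterMap Slot.subject) : o ∈ l.filterMap Slot.subject := by
  simp only [List.mem_filterMap, List.mem_map] at h ⊢
  obtain ⟨_, ⟨s, hs, rfl⟩, h⟩ := h
  refine ⟨s, hs, ?_⟩
  cases s with
  | obj p => by_cases hp : p.name = n <;> simp_all [Slot.erase, Slot.subject]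
  | hole w => exact h
  | record p => exact h

theorem filterMap_recorded_erase (n : ℕ) (l : List Slot) :
    (l.map (Slot.erase n)).filterMap Slot.recorded = l.filterMap Slot.recorded := by
  induction l with
  | nil => rfl
  | cons s l ih =>
    cases s with
    | obj o => by_cases h : o.name = n <;> simp_all [List.filterMap_cons, Slot.erase, Slot.recorded]
    | hole w => simp_all [List.filterMap_cons, Slot.erase, Slot.recorded]
    | record o => simp_all [Slot.erase, Slot.recorded]

theorem recordVolume_eraseObj (n : ℕ) (R : State) (i : ℕ) :
    recordVolume (eraseObj n R) i = recordVolume R i := by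
  simp only [recordVolume, recordedObjs, eraseObj, List.flatMap_map, Region.records,
    filterMap_recorded_erase]
  rfl

theorem storedObjs_eraseObj (n : ℕ) (R : State) :
    storedObjs (eraseObj n R) = (storedObjs R).filter fun o => o.name ≠ n := by
  simp only [storedObjs, eraseObj, List.flatMap_map, Region.objs, Region.payloadObjs,
    Region.bufferObjs, filterMap_stored_erase, List.filter_flatMap,
    List.filter_append]

theorem capacity_erase (ε : ℝ) (n : ℕ) (r : Region) :
    Region.capacity ε ⟨r.payload.map (Slot.erase n), r.buffer.map (Slot.erase n)⟩ =
      r.capacity ε := by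
  simp [Region.capacity, Region.payloadSize, slotsSize_erase]

theorem map_capacity_eraseObj (ε : ℝ) (n : ℕ) (R : State) :
    (eraseObj n R).map (Region.capacity ε) = R.map (Region.capacity ε) := by
  simp [eraseObj, capacity_erase]

theorem space_eraseObj (ε : ℝ) (n : ℕ) (R : State) : space ε (eraseObj n R) = space ε R := by
  simp only [space, eraseObj, List.map_map, Function.comp_def, Region.space, capacity_erase,
    Region.payloadSize, slotsSize_erase]
  rfl

@[simp] theorem length_eraseObj (n : ℕ) (R : State) : (eraseObj n R).length = R.length := by
  simp [eraseObj]

theorem getElem?_eraseObj {n : ℕ} {R : State} {i : ℕ} {r : Region}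
    (h : (eraseObj n R)[i]? = some r) : ∃ r₀, R[i]? = some r₀ ∧
      r = ⟨r₀.payload.map (Slot.erase n), r₀.buffer.map (Slot.erase n)⟩ := by
  simp only [eraseObj, List.getElem?_map, Option.map_eq_some_iff] at h
  obtain ⟨r₀, h0, rfl⟩ := h
  exact ⟨r₀, h0, rfl⟩

theorem filter_name_eq {A : List Obj} (hA : (A.map Obj.name).Nodup) {o : Obj} (ho : o ∈ A) :
    (A.filter fun p => p.name = o.name).Perm [o] := by
  rw [List.perm_singleton]
  induction A with
  | nil => simp at ho
  | cons p A ih =>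
    simp only [List.map_cons, List.nodup_cons, List.mem_map, not_exists, not_and] at hA
    rcases List.mem_cons.1 ho with rfl | ho
    · simp only [decide_true, List.filter_cons_of_pos, List.cons.injEq, true_and,
        List.filter_eq_nil_iff, decide_eq_true_eq]
      exact hA.1
    · rw [List.filter_cons_of_neg, ih hA.2 ho]
      simpa using fun e => hA.1 o ho e.symm

/-- Volume of the payload objects of class `i` that a deletion removes. -/
theorem Inv.volume_payload_erased {ε : ℝ} {k : ℕ} {A : List Obj} {R : State} (h : Inv ε k A R)
    {o : Obj} (ho : o ∈ A) {i : ℕ} {r : Region} (hr : R[i]? = some r) :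
    volume r.payloadObjs ≤ volume (r.payloadObjs.filter fun p => p.name ≠ o.name) +
      if sizeClass o.size = i then o.size else 0 := by
  have hsub : r.payloadObjs.Sublist (storedObjs R) :=
    (List.sublist_append_left _ _).trans
      (List.sublist_flatten_of_mem (List.mem_map_of_mem (List.mem_of_getElem? hr)))
  have hperm := (h.perm.filter fun p => p.name = o.name).trans (filter_name_eq h.names ho)
  have hvol := volume_filter_add (fun p => decide (p.name = o.name)) r.payloadObjs
  have hle : volume (r.payloadObjs.filter fun p => p.name = o.name) ≤
      if sizeClass o.size = i then o.size else 0 := by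
    split_ifs with hc
    · have := volume_sublist (hsub.filter fun p => decide (p.name = o.name))
      rw [volume_perm hperm] at this
      simpa using this
    -- A payload holds only its own class, so an object of another class cannot be erased from it.
    · rw [List.filter_eq_nil_iff.2]
      · simp
      · intro p hp hpn
        have hp' : p ∈ (storedObjs R).filter fun p => p.name = o.name :=
          List.mem_filter.2 ⟨hsub.subset hp, hpn⟩
        have : p = o := by simpa using hperm.subset hp'
        subst this
        exact hc (h.payload_class i r hr p hp)
  simp only [ne_eq, decide_not] at *
  omega

/-- Erasing an object, without a delete record for it. -/
theorem Inv.erase {ε : ℝ} {A : List Obj} {R : State} (h : Inv ε R.length A R)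
    {o : Obj} (ho : o ∈ A) {k : ℕ} (hk : k ≤ sizeClass o.size) :
    Inv ε k (A.filter fun p => p.name ≠ o.name) (eraseObj o.name R) where
  perm := by
    rw [storedObjs_eraseObj]
    exact h.perm.filter _
  names := h.names.sublist (List.filter_sublist.map _)
  pos p hp := h.pos p (List.mem_filter.1 hp).1
  payload_class i r hr p hp := by
    obtain ⟨r₀, h0, rfl⟩ := getElem?_eraseObj hr
    simp only [Region.payloadObjs, filterMap_stored_erase, List.mem_filter] at hp
    exact h.payload_class i r₀ h0 p hp.1
  buffer_class i r hr p hp := by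
    obtain ⟨r₀, h0, rfl⟩ := getElem?_eraseObj hr
    exact h.buffer_class i r₀ h0 p (subject_of_erase hp)
  used_le i r _ hr := by
    obtain ⟨r₀, h0, rfl⟩ := getElem?_eraseObj hr
    rw [capacity_erase, Region.used, slotsSize_erase]
    exact h.used_le_of_mem (List.mem_of_getElem? h0)
  payload_le i r hi hr := by
    obtain ⟨r₀, h0, rfl⟩ := getElem?_eraseObj hr
    have h1 := h.payload_le i r₀ (List.getElem?_eq_some_iff.1 h0).1 h0
    have h2 := h.volume_payload_erased ho h0
    -- Since i < k ≤ the class of the erased object, this payload loses nothing; the unpaid hole can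
    -- only be in a region outside the range of the claim.
    rw [if_neg (by omega)] at h2
    simp only [Region.payloadSize, slotsSize_erase, Region.payloadObjs, filterMap_stored_erase,
      recordVolume_eraseObj] at *
    omega

/-- Buffering a deletion. -/
theorem Inv.erase_append_record {ε : ℝ} {A : List Obj} {R : State} (h : Inv ε R.length A R)
    {o : Obj} (ho : o ∈ A) {j : ℕ} (hc : sizeClass o.size ≤ j)
    (hfit : ∃ r, (eraseObj o.name R)[j]? = some r ∧ r.used + o.size ≤ r.capacity ε) :
    Inv ε R.length (A.filter fun p => p.name ≠ o.name)
      (appendToBuffer j (.record o) (eraseObj o.name R)) where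
  perm := by
    have e : storedObjs (appendToBuffer j (.record o) (eraseObj o.name R)) =
        storedObjs (eraseObj o.name R) := by
      rw [storedObjs, appendToBuffer, List.flatMap_def, map_modify_eq]
      · rfl
      · simp [Region.objs, Region.payloadObjs, Region.bufferObjs, Slot.stored]
    rw [e]
    exact (h.erase ho le_rfl).perm
  names := (h.erase ho le_rfl).names
  pos := (h.erase ho le_rfl).pos
  payload_class i r hr := by
    obtain ⟨r₀, h0, hp, -⟩ := getElem?_appendToBuffer hr
    simpa [Region.payloadObjs, hp] using (h.erase ho le_rfl).payload_class i r₀ h0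
  buffer_class i r hr p hp := by
    obtain ⟨r₀, h0, -, hb⟩ := getElem?_appendToBuffer hr
    rw [hb, List.filterMap_append, List.mem_append] at hp
    rcases hp with hp | hp
    · exact (h.erase ho le_rfl).buffer_class i r₀ h0 p hp
    · split_ifs at hp with hji
      · simp [Slot.subject] at hp
        subst hp hji
        exact hc
      · simp at hp
  used_le i r hi hr := by
    obtain ⟨r₀, h0, hp, hb⟩ := getElem?_appendToBuffer hr
    have e : r.capacity ε = r₀.capacity ε := by simp [Region.capacity, Region.payloadSize, hp]
    rw [e, Region.used, hb]
    split_ifs with hji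
    · subst hji
      obtain ⟨r₁, h1, hle⟩ := hfit
      rw [h0, Option.some_inj] at h1
      subst h1
      simpa [slotsSize, Slot.size, Region.used] using hle
    · obtain ⟨r₁, h1, rfl⟩ := getElem?_eraseObj h0
      rw [capacity_erase, List.append_nil, slotsSize_erase]
      exact h.used_le_of_mem (List.mem_of_getElem? h1)
  payload_le i r hi hr := by
    obtain ⟨r₀, h0, hp, -⟩ := getElem?_appendToBuffer hr
    obtain ⟨r₁, h1, rfl⟩ := getElem?_eraseObj h0
    obtain ⟨_, hj, -⟩ := hfit
    have h2 := h.payload_le i r₁ hi h1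
    have h3 := h.volume_payload_erased ho h1
    -- The new record adds the full size of the object to its class, which covers the largest
    -- possible loss of stored payload volume there. If the object was buffered, the record is
    -- merely slack.
    rw [recordVolume_appendToBuffer_record o (List.getElem?_eq_some_iff.1 hj).1,
      recordVolume_eraseObj]
    simp only [Region.payloadSize, Region.payloadObjs, hp, slotsSize_erase,
      filterMap_stored_erase] at *
    omega

/-! ### New regions -/

theorem Inv.append_region {ε : ℝ} {A : List Obj} {R : State} (h : Inv ε R.length A R)
    {o : Obj} (hpos : 1 ≤ o.size) (hname : ∀ p ∈ A, p.name ≠ o.name)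
    (hc : sizeClass o.size = R.length) :
    Inv ε (R.length + 1) (A ++ [o]) (R ++ [⟨[.obj o], []⟩]) := by
  have hget : ∀ {i r}, (R ++ [⟨[.obj o], []⟩])[i]? = some r →
      R[i]? = some r ∨ i = R.length ∧ r = ⟨[.obj o], []⟩ := by
    intro i r hr
    rcases lt_trichotomy i R.length with hi | hi | hi
    · left; simpa [List.getElem?_append_left hi] using hr
    · subst hi
      right; simpa [eq_comm] using hr
    · rw [List.getElem?_eq_none (by simp; omega)] at hr
      simp at hr
  refine ⟨?_, names_append h.names hname, ?_, ?_, ?_, ?_, ?_⟩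
  · simpa [storedObjs, Region.objs, Region.payloadObjs, Region.bufferObjs, Slot.stored]
      using h.perm.append_right [o]
  · simp only [List.mem_append, List.mem_singleton]
    rintro p (hp | rfl)
    exacts [h.pos p hp, hpos]
  · intro i r hr
    rcases hget hr with hr | ⟨rfl, rfl⟩
    · exact h.payload_class i r hr
    · simpa [Region.payloadObjs, Slot.stored] using hc
  · intro i r hr
    rcases hget hr with hr | ⟨rfl, rfl⟩
    · exact h.buffer_class i r hr
    · simp
  · intro i r _ hr
    rcases hget hr with hr | ⟨rfl, rfl⟩
    · exact h.used_le_of_mem (List.mem_of_getElem? hr)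
    · simp [Region.used, slotsSize]
  · intro i r _ hr
    rw [recordVolume_append]
    rcases hget hr with hr | ⟨rfl, rfl⟩
    · have := h.payload_le i r (List.getElem?_eq_some_iff.1 hr).1 hr
      omega
    · simp [Region.payloadSize, slotsSize, Region.payloadObjs, Slot.stored, Slot.size]

theorem Inv.append_empty {ε : ℝ} {A : List Obj} {R : State} (h : Inv ε R.length A R) (n : ℕ) :
    Inv ε (R.length + n) A (R ++ List.replicate n ⟨[], []⟩) := by
  have hget : ∀ {i : ℕ} {r : Region}, (R ++ List.replicate n ⟨[], []⟩)[i]? = some r →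
      R[i]? = some r ∨ r = ⟨[], []⟩ := by
    intro i r hr
    rw [List.getElem?_append] at hr
    split_ifs at hr
    · exact Or.inl hr
    · exact Or.inr (List.eq_of_mem_replicate (List.mem_of_getElem? hr))
  refine ⟨?_, h.names, h.pos, ?_, ?_, ?_, ?_⟩
  · have e : storedObjs (R ++ List.replicate n ⟨[], []⟩) = storedObjs R := by
      simp [storedObjs, List.flatMap_append, List.flatMap_replicate, Region.objs,
        Region.payloadObjs, Region.bufferObjs]
    rw [e]
    exact h.perm
  · intro i r hr
    rcases hget hr with hr | rfl
    · exact h.payload_class i r hr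
    · simp [Region.payloadObjs]
  · intro i r hr
    rcases hget hr with hr | rfl
    · exact h.buffer_class i r hr
    · simp
  · intro i r _ hr
    rcases hget hr with hr | rfl
    · exact h.used_le_of_mem (List.mem_of_getElem? hr)
    · simp [Region.used, slotsSize]
  · intro i r _ hr
    rw [recordVolume_append]
    rcases hget hr with hr | rfl
    · have := h.payload_le i r (List.getElem?_eq_some_iff.1 hr).1 hr
      omega
    · simp [Region.payloadSize, slotsSize]

/-! ### Locations -/

theorem placeSlots_endpoint_le {a : ℕ} {l : List Slot} {y : Block} (h : y ∈ placeSlots a l) :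
    y.endpoint ≤ a + slotsSize l := by
  induction l generalizing a with
  | nil => simp [placeSlots] at h
  | cons s l ih =>
    cases s with
    | obj o =>
      simp only [placeSlots, List.mem_cons] at h
      rcases h with rfl | h
      · simp [Block.endpoint, slotsSize, Slot.size]
      · have := ih h
        simp only [slotsSize, List.map_cons, List.sum_cons, Slot.size] at *
        omega
    | hole w =>
      have := ih h
      simp only [slotsSize, List.map_cons, List.sum_cons, Slot.size] at *
      omega
    | record o =>
      have := ih h
      simp only [slotsSize, List.map_cons, List.sum_cons, Slot.size] at *
      omega

theorem map_obj_placeSlots (a : ℕ) (l : List Slot) :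
    (placeSlots a l).map Block.obj = l.filterMap Slot.stored := by
  induction l generalizing a with
  | nil => rfl
  | cons s l ih => cases s <;> simp [placeSlots, List.filterMap_cons, Slot.stored, ih]

theorem placeObjs_endpoint_le {a : ℕ} {l : List Obj} {y : Block} (h : y ∈ placeObjs a l) :
    y.endpoint ≤ a + volume l := by
  simpa [slotsSize_map_obj] using placeSlots_endpoint_le h

theorem obj_mem_of_mem_placeObjs {a : ℕ} {l : List Obj} {y : Block} (h : y ∈ placeObjs a l) :
    y.obj ∈ l := by
  have := List.mem_map_of_mem (f := Block.obj) h
  rwa [placeObjs, map_obj_placeSlots, filterMap_stored_map_obj] at this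

theorem map_obj_layout (ε : ℝ) (a : ℕ) (R : State) :
    (layout ε a R).map Block.obj = storedObjs R := by
  induction R generalizing a with
  | nil => rfl
  | cons r R ih =>
    simp only [layout, List.map_append, map_obj_placeSlots, ih]
    simp [storedObjs, Region.objs, Region.payloadObjs, Region.bufferObjs]

theorem layout_append (ε : ℝ) (a : ℕ) (R S : State) :
    layout ε a (R ++ S) = layout ε a R ++ layout ε (a + space ε R) S := by
  induction R generalizing a with
  | nil => simp [layout, space]
  | cons r R ih => simp [layout, ih, space, add_assoc]

/-- If no buffer exceeds its capacity by more than `e`, then no object ends more than `e` cells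
behind the segments. -/
theorem layout_endpoint_le {ε : ℝ} {a e : ℕ} {R : State}
    (hR : ∀ r ∈ R, r.used ≤ r.capacity ε + e) {y : Block} (h : y ∈ layout ε a R) :
    y.endpoint ≤ a + space ε R + e := by
  induction R generalizing a with
  | nil => simp [layout] at h
  | cons r R ih =>
    have hr := hR r (by simp)
    have e1 : space ε (r :: R) = r.payloadSize + r.capacity ε + space ε R := by
      simp [space, Region.space]
    simp only [layout, List.mem_append] at h
    rcases h with (h | h) | h
    · have := placeSlots_endpoint_le h
      simp only [Region.payloadSize] at *
      omega
    · have := placeSlots_endpoint_le h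
      simp only [Region.used] at *
      omega
    · have := ih (fun s hs => hR s (by simp [hs])) h
      simp only [Region.space] at this
      omega

theorem contentEnd_le {ε : ℝ} {e : ℕ} {R : State} (hR : ∀ r ∈ R, r.used ≤ r.capacity ε + e) :
    contentEnd ε R ≤ space ε R + e := by
  rcases List.eq_nil_or_concat R with rfl | ⟨S, r, rfl⟩
  · simp [contentEnd, space]
  · have := hR r (by simp)
    simp only [List.concat_eq_append, contentEnd, List.dropLast_concat, List.getLast?_append,
      List.getLast?_singleton, Option.some_or, Option.map_some, Option.getD_some, space_append]
    have : space ε [r] = r.payloadSize + r.capacity ε := by simp [space, Region.space]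
    omega

theorem Inv.layout_endpoint_le {ε : ℝ} {A : List Obj} {R : State} (h : Inv ε R.length A R)
    {y : Block} (hy : y ∈ layout ε 0 R) : y.endpoint ≤ space ε R := by
  simpa using Realloc.layout_endpoint_le (e := 0) (fun r hr => h.used_le_of_mem hr) hy

/-! ### The data structure after a flush -/

theorem filter_class_split_perm (E : List Obj) (b n : ℕ) :
    ((E.filter fun o => sizeClass o.size = b) ++
      E.filter fun o => b + 1 ≤ sizeClass o.size ∧ sizeClass o.size < b + 1 + n).Perm
    (E.filter fun o => b ≤ sizeClass o.size ∧ sizeClass o.size < b + (n + 1)) := by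
  refine .trans ?_ (List.filter_append_perm (fun o => decide (sizeClass o.size = b)) _)
  simp only [List.filter_filter]
  refine .of_eq (congrArg₂ _ ?_ ?_) <;>
  · refine List.filter_congr fun o _ => ?_
    rw [Bool.eq_iff_iff]
    simp
    omega

/-- The flushed regions, without the removal of empty ones. -/
def rebuiltRegions (E : List Obj) (b : ℕ) (D : State) : State :=
  D.mapIdx fun i r =>
    { payload := (r.payloadObjs ++ E.filter fun o => sizeClass o.size = b + i).map Slot.obj
      buffer := [] }

theorem flushed_eq (order : List Obj → List Obj) (b : ℕ) (R : State) :
    flushed order b R = (R.take b ++ rebuiltRegions (evacuated order b R) b (R.drop b)).rdropWhile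
      fun r => r.payload.isEmpty := rfl

theorem rebuiltRegions_cons (E : List Obj) (b : ℕ) (r : Region) (D : State) :
    rebuiltRegions E b (r :: D) =
      ⟨(r.payloadObjs ++ E.filter fun o => sizeClass o.size = b).map Slot.obj, []⟩ ::
        rebuiltRegions E (b + 1) D := by
  simp [rebuiltRegions, List.mapIdx_cons, add_comm, add_left_comm]

/-- Rebuilding distributes the evacuated objects by class, so those outside the range of rebuilt
classes would be lost. The filter keeps track of this; `Inv.flushed` shows that nothing is filtered
out. -/
theorem storedObjs_rebuiltRegions (E : List Obj) (b : ℕ) (D : State) :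
    (storedObjs (rebuiltRegions E b D)).Perm (D.flatMap Region.payloadObjs ++
      E.filter fun o => b ≤ sizeClass o.size ∧ sizeClass o.size < b + D.length) := by
  induction D generalizing b with
  | nil =>
    rw [List.filter_eq_nil_iff.2]
    · rfl
    · simp
  | cons r D ih =>
    have h1 := ih (b + 1)
    rw [rebuiltRegions_cons]
    simp only [storedObjs, List.flatMap_cons, Region.objs, List.length_cons] at h1 ⊢
    rw [Region.payloadObjs, filterMap_stored_map_obj]
    simp only [Region.bufferObjs, List.filterMap_nil, List.append_nil, List.append_assoc]
    refine List.Perm.append_left _ ?_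
    refine (h1.append_left _).trans ?_
    rw [← List.append_assoc]
    refine (List.perm_append_comm.append_right _).trans ?_
    rw [List.append_assoc]
    exact (filter_class_split_perm E b D.length).append_left _

theorem storedObjs_perm (R : State) :
    (storedObjs R).Perm (R.flatMap Region.payloadObjs ++ R.flatMap Region.bufferObjs) := by
  induction R with
  | nil => rfl
  | cons r R ih =>
    simp only [storedObjs, List.flatMap_cons, Region.objs, List.append_assoc] at ih ⊢
    refine List.Perm.append_left _ ((ih.append_left _).trans ?_)
    rw [← List.append_assoc, ← List.append_assoc]
    exact List.perm_append_comm.append_right _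

theorem getElem?_rebuilt {E : List Obj} {b : ℕ} {R : State} {i : ℕ} {r : Region}
    (h : (R.take b ++ rebuiltRegions E b (R.drop b))[i]? = some r) :
    (i < b ∧ R[i]? = some r) ∨ (b ≤ i ∧ ∃ r₀, R[i]? = some r₀ ∧
      r = ⟨(r₀.payloadObjs ++ E.filter fun o => sizeClass o.size = i).map Slot.obj, []⟩) := by
  rw [List.getElem?_append] at h
  split_ifs at h with hi
  · rw [List.length_take] at hi
    rw [List.getElem?_take_of_lt (by omega)] at h
    exact Or.inl ⟨by omega, h⟩
  · rw [List.length_take, not_lt] at hi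
    simp only [rebuiltRegions, List.getElem?_mapIdx, List.getElem?_drop, Option.map_eq_some_iff,
      List.length_take] at h
    obtain ⟨r₀, h0, rfl⟩ := h
    have h1 := (List.getElem?_eq_some_iff.1 h0).1
    -- An entry was found behind the first b regions, so b < `R.length` and the minimum is b.
    have e : b + (i - min b R.length) = i := by omega
    rw [e] at h0
    exact Or.inr ⟨by omega, r₀, h0, by rw [e]⟩

/-- An empty region at the end may be removed. -/
theorem Inv.dropLast {ε : ℝ} {A : List Obj} {R : State} {r : Region}
    (h : Inv ε (R ++ [r]).length A (R ++ [r])) (hr : r.payload = []) : Inv ε R.length A R := by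
  -- An empty payload gives a buffer of capacity 0. Stored objects have positive length, so it holds
  -- none, and its records have total volume 0.
  have hused : r.used = 0 := by
    have := h.used_le_of_mem (r := r) (by simp)
    simpa [Region.capacity, Region.payloadSize, hr, slotsSize] using this
  have hvol := volume_stored_add_recorded_le r.buffer
  have hobjs : r.objs = [] := by
    have hp : r.payloadObjs = [] := by simp [Region.payloadObjs, hr]
    rw [Region.objs, hp, List.nil_append, List.eq_nil_iff_forall_not_mem]
    intro o ho
    have h1 := size_le_volume ho
    have h2 := h.pos o (h.perm.subset (mem_storedObjs_of_buffer (by simp) ho))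
    simp only [Region.used, Region.bufferObjs] at *
    omega
  have hrec : ∀ i, recordVolume [r] i = 0 := by
    intro i
    have h1 := volume_sublist
      (List.filter_sublist (p := fun o : Obj => decide (sizeClass o.size = i)) (l := r.records))
    simp only [recordVolume, recordedObjs, List.flatMap_singleton, Region.used,
      Region.records] at *
    omega
  have hget : ∀ {i s}, R[i]? = some s → (R ++ [r])[i]? = some s := fun {i s} hs => by
    rw [List.getElem?_append_left (List.getElem?_eq_some_iff.1 hs).1, hs]
  refine ⟨?_, h.names, h.pos, fun i s hs => h.payload_class i s (hget hs),
    fun i s hs => h.buffer_class i s (hget hs),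
    fun i s hi hs => h.used_le i s (by simp; omega) (hget hs), fun i s hi hs => ?_⟩
  · have e : storedObjs (R ++ [r]) = storedObjs R := by simp [storedObjs, hobjs]
    rw [← e]
    exact h.perm
  · simpa [recordVolume_append, hrec] using h.payload_le i s (by simp; omega) (hget hs)

theorem Inv.rdropWhile {ε : ℝ} {A : List Obj} {R : State} (h : Inv ε R.length A R) :
    Inv ε (R.rdropWhile fun r => r.payload.isEmpty).length A
      (R.rdropWhile fun r => r.payload.isEmpty) := by
  induction R using List.reverseRecOn with
  | nil => simpa using h
  | append_singleton R r ih =>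
    rw [List.rdropWhile_concat]
    split_ifs with hr
    · exact ih (h.dropLast (by simpa using hr))
    · exact h

theorem space_rdropWhile (ε : ℝ) (R : State) :
    space ε (R.rdropWhile fun r => r.payload.isEmpty) = space ε R := by
  induction R using List.reverseRecOn with
  | nil => rfl
  | append_singleton R r ih =>
    rw [List.rdropWhile_concat]
    split_ifs with hr
    · have hr' : r.payload = [] := by simpa using hr
      rw [ih, space_append]
      simp [space, Region.space, Region.capacity, Region.payloadSize, slotsSize, hr']
    · rfl

theorem space_take_le_flushed (ε : ℝ) (order : List Obj → List Obj) (b : ℕ) (R : State) :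
    space ε (R.take b) ≤ space ε (flushed order b R) := by
  rw [flushed_eq, space_rdropWhile, space_append]
  exact Nat.le_add_right _ _

/-- This is the purpose of the boundary class: emptying the buffers from b on discards no record
that pays for a hole in an unflushed region. -/
theorem recordVolume_drop_eq_zero {b : ℕ} {R : State}
    (hb : ∀ r ∈ R.drop b, ∀ o ∈ r.buffer.filterMap Slot.subject, b ≤ sizeClass o.size)
    {i : ℕ} (hi : i < b) : recordVolume (R.drop b) i = 0 := by
  rw [recordVolume, List.filter_eq_nil_iff.2]
  · rfl
  · intro o ho hc
    obtain ⟨r, hr, ho⟩ := List.mem_flatMap.1 ho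
    have := hb r hr o (subject_of_recorded ho)
    simp at hc
    omega

/-- Rebuilt regions have no holes and empty buffers, so they satisfy the size conditions whatever
held before. An invariant restricted to the first b regions thus becomes a full one. -/
theorem Inv.flushed {ε : ℝ} {order : List Obj → List Obj} (horder : ∀ l, (order l).Perm l)
    {b : ℕ} {A : List Obj} {R : State} (h : Inv ε b A R)
    (hb : ∀ r ∈ R.drop b, ∀ o ∈ r.buffer.filterMap Slot.subject, b ≤ sizeClass o.size) :
    Inv ε (flushed order b R).length A (flushed order b R) := by
  rw [flushed_eq]
  have hevac : (evacuated order b R).Perm ((R.drop b).flatMap Region.bufferObjs) := horder _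
  apply Inv.rdropWhile
  refine ⟨?_, h.names, h.pos, ?_, ?_, ?_, ?_⟩
  · refine .trans ?_ h.perm
    nth_rewrite 4 [← List.take_append_drop b R]
    simp only [storedObjs, List.flatMap_append]
    refine List.Perm.append_left _ ?_
    refine (storedObjs_rebuiltRegions _ _ _).trans (.trans ?_ (storedObjs_perm (R.drop b)).symm)
    refine List.Perm.append_left _ (.trans (.of_eq ?_) hevac)
    -- No evacuated object is lost: its class is at least b by the choice of b, and at most the
    -- index of the buffer it came from, so it has a rebuilt region.
    rw [List.filter_eq_self]
    intro o ho
    obtain ⟨r, hr, ho⟩ := List.mem_flatMap.1 (hevac.subset ho)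
    have h1 := hb r hr o (subject_of_stored ho)
    obtain ⟨i, hi, rfl⟩ := List.mem_iff_getElem.1 hr
    have h2 := h.buffer_class (b + i) ((R.drop b)[i])
      (by rw [← List.getElem?_drop, List.getElem?_eq_getElem hi]) o (subject_of_stored ho)
    rw [decide_eq_true_eq]
    omega
  · intro i r hr
    rcases getElem?_rebuilt hr with ⟨-, hr⟩ | ⟨-, r₀, h0, rfl⟩
    · exact h.payload_class i r hr
    · intro o ho
      rw [Region.payloadObjs, filterMap_stored_map_obj, List.mem_append] at ho
      rcases ho with ho | ho
      · exact h.payload_class i r₀ h0 o ho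
      · simpa using (List.mem_filter.1 ho).2
  · intro i r hr
    rcases getElem?_rebuilt hr with ⟨-, hr⟩ | ⟨-, r₀, h0, rfl⟩
    · exact h.buffer_class i r hr
    · simp
  · intro i r _ hr
    rcases getElem?_rebuilt hr with ⟨hi, hr⟩ | ⟨-, r₀, h0, rfl⟩
    · exact h.used_le i r hi hr
    · simp [Region.used, slotsSize]
  · intro i r _ hr
    rcases getElem?_rebuilt hr with ⟨hi, hr⟩ | ⟨-, r₀, h0, rfl⟩
    · have h1 := h.payload_le i r hi hr
      rw [← List.take_append_drop b R, recordVolume_append, recordVolume_drop_eq_zero hb hi] at h1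
      rw [recordVolume_append]
      omega
    · simp only [Region.payloadSize, Region.payloadObjs, slotsSize_map_obj,
        filterMap_stored_map_obj]
      exact Nat.le_add_right _ _

theorem boundary_le (R : State) (c : ℕ) : boundary R c ≤ c := Nat.findGreatest_le _

/-- The value 0 always qualifies, so the search cannot return an unqualified default. -/
theorem boundary_spec (R : State) (c : ℕ) : ∀ r ∈ R.drop (boundary R c),
    ∀ o ∈ r.buffer.filterMap Slot.subject, boundary R c ≤ sizeClass o.size :=
  Nat.findGreatest_spec (P := fun b => ∀ r ∈ R.drop b, ∀ o ∈ r.buffer.filterMap Slot.subject,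
    b ≤ sizeClass o.size) (Nat.zero_le c) (by simp)

/-! ### Executing the actions of a flush -/

/-- Only moves create copies, and a freed copy was live before. To bound every intermediate memory
it therefore suffices to bound the initial copies and all targets. -/
theorem mem_memory_of_mem_scanl {as : List Action} {start m : Memory}
    (hm : m ∈ as.scanl Memory.act start) {y : Block} (hy : y ∈ m.live ++ m.freed) :
    y ∈ start.live ++ start.freed ∨ Action.move y ∈ as := by
  induction as generalizing start with
  | nil =>
    rw [List.scanl_nil, List.mem_singleton] at hm
    exact Or.inl (hm ▸ hy)
  | cons a as ih =>
    rw [List.scanl_cons, List.mem_cons] at hm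
    rcases hm with rfl | hm
    · exact Or.inl hy
    · rcases ih hm with h | h
      · cases a with
        | move x =>
          simp only [Memory.act, List.mem_append, List.mem_filter, List.mem_singleton] at h
          rcases h with (h | rfl) | h | h
          · exact Or.inl (List.mem_append_left _ h.1)
          · exact Or.inr (by simp)
          · exact Or.inl (List.mem_append_right _ h)
          · exact Or.inl (List.mem_append_left _ h.1)
        | checkpoint =>
          simp only [Memory.act, List.append_nil] at h
          exact Or.inl (List.mem_append_left _ h)
      · exact Or.inr (List.mem_cons_of_mem _ h)

/-- A move frees every live copy of its object, so an initial copy stays live only if its object is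
never moved. -/
theorem mem_live_foldl {as : List Action} {start : Memory} {y : Block}
    (hy : y ∈ (as.foldl Memory.act start).live) :
    Action.move y ∈ as ∨ y ∈ start.live ∧ ∀ x, Action.move x ∈ as → x.obj ≠ y.obj := by
  induction as generalizing start with
  | nil => exact Or.inr ⟨hy, by simp⟩
  | cons a as ih =>
    rcases ih hy with h | ⟨h, hne⟩
    · exact Or.inl (List.mem_cons_of_mem _ h)
    · cases a with
      | move x =>
        simp only [Memory.act, List.mem_append, List.mem_filter, List.mem_singleton,
          decide_eq_true_eq] at h
        rcases h with ⟨h, hx⟩ | rfl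
        · refine Or.inr ⟨h, fun z hz => ?_⟩
          rcases List.mem_cons.1 hz with hz | hz
          · cases hz
            exact hx.symm
          · exact hne z hz
        · exact Or.inl (by simp)
      | checkpoint =>
        refine Or.inr ⟨h, fun z hz => ?_⟩
        exact hne z (by simpa using hz)

/-- The division into phases only inserts checkpoints. -/
theorem move_mem_packPhases {bound v : ℕ} {l : List Block} {y : Block} :
    Action.move y ∈ packPhases bound v l ↔ y ∈ l := by
  induction l generalizing v with
  | nil => simp [packPhases]
  | cons x l ih =>
    rw [packPhases]
    split_ifs <;> simp [ih]

theorem move_mem_unpackPhases {bound a : ℕ} {l : List Block} {y : Block} :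
    Action.move y ∈ unpackPhases bound a l ↔ y ∈ l := by
  induction l generalizing a with
  | nil => simp [unpackPhases]
  | cons x l ih =>
    rw [unpackPhases]
    split_ifs <;> simp [ih]

/-- The location `M` behind which a flush puts the buffered objects. -/
noncomputable def flushPivot (ε : ℝ) (order : List Obj → List Obj) (b : ℕ) (R : State)
    (w Δ : ℕ) : ℕ :=
  max (contentEnd ε R - w) (space ε (flushed order b R) - w) +
    ((R.drop b).map (Region.capacity ε)).sum + Δ

/-- The moves of a flush to temporary locations. -/
noncomputable def outwardActions (ε : ℝ) (order : List Obj → List Obj) (b : ℕ) (R : State)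
    (w Δ : ℕ) : List Action :=
  (placeObjs (flushPivot ε order b R w Δ) (evacuated order b R)).map .move ++ [.checkpoint] ++
  packPhases (((R.drop b).map (Region.capacity ε)).sum + Δ) 0
    (placeObjs (flushPivot ε order b R w Δ - volume ((R.drop b).flatMap Region.payloadObjs))
      ((R.drop b).flatMap Region.payloadObjs)).reverse

/-- The moves of a flush to final locations. -/
noncomputable def inwardActions (ε : ℝ) (order : List Obj → List Obj) (b : ℕ) (R : State)
    (Δ : ℕ) : List Action :=
  unpackPhases (((R.drop b).map (Region.capacity ε)).sum + Δ) (space ε (R.take b))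
    ((layout ε 0 (flushed order b R)).filter
      fun x => x.obj ∈ (R.drop b).flatMap Region.payloadObjs) ++
  ((evacuated order b R).flatMap fun o =>
    ((layout ε 0 (flushed order b R)).filter fun x => x.obj = o).map .move)

theorem flushActions_eq (ε : ℝ) (order : List Obj → List Obj) (b : ℕ) (R : State) (w Δ : ℕ) :
    flushActions ε order b R w Δ =
      outwardActions ε order b R w Δ ++ inwardActions ε order b R Δ ++ [.checkpoint] := by
  simp only [flushActions, outwardActions, inwardActions, flushPivot, List.append_assoc]

theorem move_mem_outwardActions {ε : ℝ} {order : List Obj → List Obj} {b : ℕ} {R : State}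
    {w Δ : ℕ} {y : Block} : Action.move y ∈ outwardActions ε order b R w Δ ↔
      y ∈ placeObjs (flushPivot ε order b R w Δ) (evacuated order b R) ∨
      y ∈ placeObjs
        (flushPivot ε order b R w Δ - volume ((R.drop b).flatMap Region.payloadObjs))
        ((R.drop b).flatMap Region.payloadObjs) := by
  simp [outwardActions, move_mem_packPhases]

theorem move_mem_inwardActions {ε : ℝ} {order : List Obj → List Obj} {b : ℕ} {R : State}
    {Δ : ℕ} {y : Block} : Action.move y ∈ inwardActions ε order b R Δ ↔
      y ∈ layout ε 0 (flushed order b R) ∧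
        (y.obj ∈ (R.drop b).flatMap Region.payloadObjs ∨ y.obj ∈ evacuated order b R) := by
  simp only [inwardActions, List.mem_append, move_mem_unpackPhases, List.mem_filter,
    decide_eq_true_eq, List.mem_flatMap (l := evacuated order b R), List.mem_map,
    Action.move.injEq, exists_eq_right]
  constructor
  · rintro (⟨h, h'⟩ | ⟨o, ho, h, rfl⟩)
    exacts [⟨h, Or.inl h'⟩, ⟨h, Or.inr ho⟩]
  · rintro ⟨h, h' | h'⟩
    exacts [Or.inl ⟨h, h'⟩, Or.inr ⟨_, h', h, rfl⟩]

/-- After a flush all objects are within the segments. -/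
theorem final_endpoint_le {ε : ℝ} {order : List Obj → List Obj} (horder : ∀ l, (order l).Perm l)
    {b : ℕ} {A : List Obj} {R : State} (h : Inv ε b A R)
    (hb : ∀ r ∈ R.drop b, ∀ o ∈ r.buffer.filterMap Slot.subject, b ≤ sizeClass o.size)
    {w Δ : ℕ} {freed : List Block} {y : Block}
    (hy : y ∈ ((flushActions ε order b R w Δ).foldl Memory.act ⟨layout ε 0 R, freed⟩).live) :
    y.endpoint ≤ space ε (flushed order b R) := by
  have hinv := h.flushed horder hb
  rw [flushActions_eq, List.foldl_append, List.foldl_append] at hy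
  change y ∈ ((inwardActions ε order b R Δ).foldl Memory.act _).live at hy
  rcases mem_live_foldl hy with hy | ⟨hy, hne⟩
  · exact hinv.layout_endpoint_le (move_mem_inwardActions.1 hy).1
  have hevac : (evacuated order b R).Perm ((R.drop b).flatMap Region.bufferObjs) := horder _
  -- Every object of the flushed regions has a place in the new layout and is moved there, so a copy
  -- untouched by the inward moves belongs to another object. This excludes the targets of outward
  -- moves and leaves only initial copies in the first b regions.
  have hnot : y.obj ∉ storedObjs (R.drop b) := by
    intro ho
    have hstored : y.obj ∈ storedObjs (flushed order b R) := by
      refine (hinv.perm.trans h.perm.symm).symm.subset ?_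
      rw [← List.take_append_drop b R]
      simp only [storedObjs, List.flatMap_append, List.mem_append]
      exact Or.inr ho
    rw [← map_obj_layout ε 0] at hstored
    obtain ⟨x, hx, hxy⟩ := List.mem_map.1 hstored
    refine hne x (move_mem_inwardActions.2 ⟨hx, ?_⟩) hxy
    rw [hxy]
    rcases List.mem_append.1 ((storedObjs_perm _).subset ho) with ho | ho
    · exact Or.inl ho
    · exact Or.inr (hevac.symm.subset ho)
  rcases mem_live_foldl hy with hy | ⟨hy, -⟩
  · refine absurd ((storedObjs_perm _).symm.subset ?_) hnot
    rcases move_mem_outwardActions.1 hy with hy | hy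
    · exact List.mem_append_right _ (hevac.subset (obj_mem_of_mem_placeObjs hy))
    · exact List.mem_append_left _ (obj_mem_of_mem_placeObjs hy)
  · rw [← List.take_append_drop b R, layout_append, List.mem_append] at hy
    rcases hy with hy | hy
    · refine le_trans ?_ (space_take_le_flushed ε order b R)
      have := layout_endpoint_le (e := 0) (fun r hr => ?_) hy
      · simpa using this
      · obtain ⟨i, hi, rfl⟩ := List.mem_iff_getElem.1 hr
        rw [List.length_take] at hi
        rw [List.getElem_take]
        exact h.used_le i _ (by omega) (List.getElem?_eq_getElem _)
    · refine absurd ?_ hnot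
      rw [← map_obj_layout ε (0 + space ε (R.take b))]
      exact List.mem_map_of_mem hy

/-! ### Footprints -/

theorem footprint_le {m : Moment} {X : ℝ} (hs : (m.segmentsEnd : ℝ) ≤ X)
    (hm : ∀ y ∈ m.memory.live ++ m.memory.freed, (y.endpoint : ℝ) ≤ X) :
    (m.footprint : ℝ) ≤ X := by
  have h0 : 0 ≤ X := le_trans (Nat.cast_nonneg _) hs
  rw [Moment.footprint, Nat.cast_max]
  refine max_le hs ?_
  generalize m.memory.live ++ m.memory.freed = l at hm
  induction l with
  | nil => simpa using h0
  | cons y l ih =>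
    simp only [List.map_cons, List.foldr_cons, Nat.cast_max]
    exact max_le (hm y (by simp)) (ih fun z hz => hm z (by simp [hz]))

/-- The bound on the footprint at a given moment. -/
def Moment.Bounded (ε : ℝ) (m : Moment) : Prop :=
  (m.footprint : ℝ) ≤ (1 + 8 * ε) * (volume m.active : ℝ) + (longest m.active : ℝ)

theorem Inv.bounded_of_le_space {ε : ℝ} (hε : 0 < ε) (hε' : ε ≤ 1 / 2) {A : List Obj}
    {R : State} (h : Inv ε R.length A R) {μ : Memory}
    (hμ : ∀ y ∈ μ.live ++ μ.freed, y.endpoint ≤ space ε R) :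
    Moment.Bounded ε ⟨μ, space ε R, A⟩ := by
  have h1 := h.space_le hε hε'
  have h2 : (0 : ℝ) ≤ ε * volume A := by positivity
  have h3 : (0 : ℝ) ≤ longest A := by positivity
  have h4 : (space ε R : ℝ) ≤ (1 + 8 * ε) * volume A + longest A := by linarith
  exact footprint_le h4 fun y hy => le_trans (Nat.cast_le.2 (hμ y hy)) h4

theorem Inv.bounded {ε : ℝ} (hε : 0 < ε) (hε' : ε ≤ 1 / 2) {A : List Obj} {R : State}
    (h : Inv ε R.length A R) : Moment.Bounded ε ⟨⟨layout ε 0 R, []⟩, space ε R, A⟩ :=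
  h.bounded_of_le_space hε hε' fun y hy => h.layout_endpoint_le (by simpa using hy)

/-- All moments of a flush satisfy the bound if its data structure does, up to an excess `w` over
the capacity of the last buffer. -/
theorem flush_bounded {ε : ℝ} (hε : 0 < ε) (hε' : ε ≤ 1 / 2) {order : List Obj → List Obj}
    (horder : ∀ l, (order l).Perm l) {b w : ℕ} {A A' : List Obj} {R : State} (h : Inv ε b A' R)
    (hb : ∀ r ∈ R.drop b, ∀ o ∈ r.buffer.filterMap Slot.subject, b ≤ sizeClass o.size)
    (hA : volume A' ≤ volume A)
    (hused : ∀ r ∈ R, r.used ≤ r.capacity ε + w)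
    (hsum : ((R.drop b).map Region.used).sum ≤ ((R.drop b).map (Region.capacity ε)).sum + w)
    (hspace : (space ε R : ℝ) + 2 * (R.map (Region.capacity ε)).sum + w ≤
      (1 + 8 * ε) * volume A)
    (hcap : ((R.map (Region.capacity ε)).sum : ℝ) ≤ 2 * ε * volume A)
    {freed : List Block} (hfreed : ∀ y ∈ freed, y.endpoint ≤ space ε R) :
    ∀ m ∈ flushMoments ε order b R w ⟨layout ε 0 R, freed⟩ A A', m.Bounded ε := by
  have hinv := h.flushed horder hb
  have hnew := hinv.space_le hε hε'
  have hA' : (volume A' : ℝ) ≤ volume A := Nat.cast_le.2 hA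
  have hεA : (0 : ℝ) ≤ ε * volume A := by positivity
  have hεA' : ε * volume A' ≤ ε * volume A := by gcongr
  have hdrop : (((R.drop b).map (Region.capacity ε)).sum : ℝ) ≤
      (R.map (Region.capacity ε)).sum := Nat.cast_le.2 (sum_capacity_drop_le ε R b)
  have hΔ : (0 : ℝ) ≤ longest A := by positivity
  have hw : (0 : ℝ) ≤ w := by positivity
  have hC : (0 : ℝ) ≤ (R.map (Region.capacity ε)).sum := Nat.cast_nonneg _
  have hevac : volume (evacuated order b R) ≤ ((R.drop b).map (Region.capacity ε)).sum + w := by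
    rw [evacuated, volume_perm (horder _), volume_flatMap]
    exact le_trans (List.sum_le_sum fun r _ => volume_stored_le r.buffer) hsum
  -- The contents end at most w behind the segments, so L is at most the old space. The w from the
  -- evacuated volume cancels the one subtracted from the new space; if that subtraction truncates
  -- to 0, the first entry of the maximum still covers w.
  have hpivot : flushPivot ε order b R w (longest A) + volume (evacuated order b R) ≤
      max (space ε R + w) (space ε (flushed order b R)) +
        2 * ((R.drop b).map (Region.capacity ε)).sum + longest A := by
    have := contentEnd_le hused
    rw [flushPivot]
    omega
  have hpivot' : ((flushPivot ε order b R w (longest A) : ℕ) : ℝ) +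
      (volume (evacuated order b R) : ℕ) ≤ (1 + 8 * ε) * volume A + longest A := by
    have h1 : ((flushPivot ε order b R w (longest A) : ℕ) : ℝ) +
      (volume (evacuated order b R) : ℕ) ≤
        max ((space ε R : ℝ) + w) (space ε (flushed order b R)) +
        2 * (((R.drop b).map (Region.capacity ε)).sum : ℕ) + longest A := by
      exact_mod_cast hpivot
    rcases max_cases ((space ε R : ℝ) + w) (space ε (flushed order b R)) with h2 | h2 <;>
      rw [h2.1] at h1 <;> linarith
  -- Covers the truncated case of the packing address M - volume: the packed objects would then
  -- start at 0 and end at their own volume.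
  have hpayload : (volume ((R.drop b).flatMap Region.payloadObjs) : ℝ) ≤ volume A := by
    refine le_trans (Nat.cast_le.2 ?_) hA'
    rw [← volume_perm h.perm, storedObjs, volume_flatMap, volume_flatMap]
    refine le_trans (List.sum_le_sum (g := fun r => volume r.objs) fun r _ => ?_)
      (((List.drop_sublist b R).map _).sum_le_sum (by simp))
    simp [Region.objs]
  intro m hm
  rw [flushMoments, List.mem_append, List.mem_map, List.mem_singleton] at hm
  rcases hm with ⟨μ, hμ, rfl⟩ | rfl
  · refine footprint_le ?_ fun y hy => ?_
    · rw [Nat.cast_max]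
      exact max_le (by linarith) (by linarith)
    · simp only at hy ⊢
      rcases mem_memory_of_mem_scanl hμ hy with hy | hy
      · rcases List.mem_append.1 hy with hy | hy
        · have : (y.endpoint : ℝ) ≤ space ε R + w := by
            exact_mod_cast (by simpa using layout_endpoint_le hused hy :
              y.endpoint ≤ space ε R + w)
          linarith
        · have : (y.endpoint : ℝ) ≤ space ε R := Nat.cast_le.2 (hfreed y hy)
          linarith
      · rw [flushActions_eq, List.mem_append, List.mem_append] at hy
        rcases hy with (hy | hy) | hy
        · rcases move_mem_outwardActions.1 hy with hy | hy
          · refine le_trans ?_ hpivot'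
            exact_mod_cast placeObjs_endpoint_le hy
          · have h1 := placeObjs_endpoint_le hy
            have h2 : y.endpoint ≤ max (flushPivot ε order b R w (longest A))
                (volume ((R.drop b).flatMap Region.payloadObjs)) := by omega
            have h3 : (y.endpoint : ℝ) ≤ max (flushPivot ε order b R w (longest A) : ℝ)
                (volume ((R.drop b).flatMap Region.payloadObjs)) := by exact_mod_cast h2
            refine h3.trans (max_le ?_ (by linarith))
            exact le_trans (le_add_of_nonneg_right (Nat.cast_nonneg _)) hpivot'
        · have : (y.endpoint : ℝ) ≤ space ε (flushed order b R) :=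
            Nat.cast_le.2 (hinv.layout_endpoint_le (move_mem_inwardActions.1 hy).1)
          linarith
        · simp at hy
  · have e : ((flushActions ε order b R w (longest A)).scanl Memory.act
        ⟨layout ε 0 R, freed⟩).getLastD ⟨layout ε 0 R, freed⟩ =
        (flushActions ε order b R w (longest A)).foldl Memory.act ⟨layout ε 0 R, freed⟩ := by
      rw [List.getLastD_eq_getLast?, List.getLast?_scanl, Option.getD_some]
    simp only [e]
    refine hinv.bounded_of_le_space hε hε' fun y hy => ?_
    refine final_endpoint_le horder h hb (w := w) (Δ := longest A) (freed := freed) ?_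
    -- The last action is a checkpoint, so no freed copies remain.
    have e' : ((flushActions ε order b R w (longest A)).foldl Memory.act
        ⟨layout ε 0 R, freed⟩).freed = [] := by
      rw [flushActions_eq, List.foldl_append]
      rfl
    simpa [e'] using hy

/-! ### Processing requests -/

theorem used_appendToBuffer_le {ε : ℝ} {R : State} (hR : ∀ r ∈ R, r.used ≤ r.capacity ε)
    (j : ℕ) (s : Slot) : ∀ r ∈ appendToBuffer j s R, r.used ≤ r.capacity ε + s.size := by
  intro r hr
  obtain ⟨i, hi⟩ := List.mem_iff_getElem?.1 hr
  obtain ⟨r₀, h0, hp, hbuf⟩ := getElem?_appendToBuffer hi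
  have e : r.capacity ε = r₀.capacity ε := by simp [Region.capacity, Region.payloadSize, hp]
  have := hR r₀ (List.mem_of_getElem? h0)
  rw [e, Region.used, hbuf]
  split_ifs <;> simp [slotsSize, Region.used] at * <;> omega

theorem insertObj_spec {ε : ℝ} (hε : 0 < ε) (hε' : ε ≤ 1 / 2) {order : List Obj → List Obj}
    (horder : ∀ l, (order l).Perm l) {A : List Obj} {R : State} (h : Inv ε R.length A R)
    {o : Obj} (hpos : 1 ≤ o.size) (hname : ∀ p ∈ A, p.name ≠ o.name) :
    (∀ m ∈ (insertObj ε order R A o).1, m.Bounded ε) ∧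
      Inv ε (insertObj ε order R A o).2.length (A ++ [o]) (insertObj ε order R A o).2 := by
  simp only [insertObj]
  split_ifs with hc
  · have h1 := h.append_empty (sizeClass o.size - R.length)
    have hlen : (R ++ List.replicate (sizeClass o.size - R.length) (⟨[], []⟩ : Region)).length =
        R.length + (sizeClass o.size - R.length) := by simp
    rw [← hlen] at h1
    have h2 := h1.append_region hpos hname (by omega)
    have hlen' : ∀ (S : State) (r : Region), S.length + 1 = (S ++ [r]).length := by simp
    rw [hlen' _ ⟨[.obj o], []⟩] at h2
    exact ⟨by simpa using h2.bounded hε hε', h2⟩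
  · rcases hf : findBuffer ε R (sizeClass o.size) o.size with _ | j
    · simp only
      have hlast : R.length - 1 < R.length := by omega
      have hbound := boundary_le (appendToBuffer (R.length - 1) (.obj o) R) (sizeClass o.size)
      have hspec := boundary_spec (appendToBuffer (R.length - 1) (.obj o) R) (sizeClass o.size)
      generalize boundary (appendToBuffer (R.length - 1) (.obj o) R) (sizeClass o.size) = b at *
      -- The boundary is at most the class of the object, which is at most the last index; the
      -- overfull buffer is thus outside the first b regions and the fitting condition is vacuous.
      have h1 : Inv ε b (A ++ [o]) (appendToBuffer (R.length - 1) (.obj o) R) :=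
        h.append_obj hpos hname hlast (by omega) (by omega) (by omega)
      refine ⟨?_, h1.flushed horder hspec⟩
      have h2 := h.space_add_le hε hε'
      have h3 := h.capacity_le hε hε'
      have h4 : (0 : ℝ) ≤ ε * o.size := by positivity
      refine flush_bounded (w := o.size) hε hε' horder h1 hspec le_rfl
        (used_appendToBuffer_le (fun r hr => h.used_le_of_mem hr) _ _) ?_ ?_ ?_ (by simp)
      · rw [List.map_drop (f := Region.capacity ε), map_capacity_appendToBuffer, ← List.map_drop]
        refine (sum_map_modify_le Region.used _ o.size (fun r => ?_) R _ b).trans ?_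
        · simp [Region.used, slotsSize, Slot.size]
        · gcongr
          exact List.sum_le_sum fun r hr => h.used_le_of_mem (List.mem_of_mem_drop hr)
      -- Segments and capacities are those before the insertion, bounded by the old volume; the new
      -- object adds w on the left and (1 + 8ε)w on the right.
      · rw [space_appendToBuffer, map_capacity_appendToBuffer, volume_append, volume_cons,
          volume_nil, add_zero, Nat.cast_add]
        linarith
      · rw [map_capacity_appendToBuffer, volume_append, volume_cons, volume_nil, add_zero,
          Nat.cast_add]
        linarith
    · obtain ⟨hcj, r, hr, hfit⟩ := findBuffer_some hf
      have h1 : Inv ε (appendToBuffer j (.obj o) R).length (A ++ [o])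
          (appendToBuffer j (.obj o) R) := by
        refine h.append_obj hpos hname (List.getElem?_eq_some_iff.1 hr).1 hcj (by simp) ?_
        intro _ s hs
        rw [hr, Option.some_inj] at hs
        exact hs ▸ hfit
      exact ⟨by simpa using h1.bounded hε hε', h1⟩

theorem deleteObj_spec {ε : ℝ} (hε : 0 < ε) (hε' : ε ≤ 1 / 2) {order : List Obj → List Obj}
    (horder : ∀ l, (order l).Perm l) {A : List Obj} {R : State} (h : Inv ε R.length A R)
    {o : Obj} (ho : o ∈ A) :
    (∀ m ∈ (deleteObj ε order R A o).1, m.Bounded ε) ∧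
      Inv ε (deleteObj ε order R A o).2.length (A.filter fun p => p.name ≠ o.name)
        (deleteObj ε order R A o).2 := by
  have hold : ∀ y ∈ (layout ε 0 R).filter (fun x => x.obj.name = o.name),
      y.endpoint ≤ space ε R := fun y hy => h.layout_endpoint_le (List.mem_filter.1 hy).1
  simp only [deleteObj]
  rcases hf : findBuffer ε (eraseObj o.name R) (sizeClass o.size) o.size with _ | j
  · simp only
    have hbound := boundary_le (eraseObj o.name R) (sizeClass o.size)
    have hspec := boundary_spec (eraseObj o.name R) (sizeClass o.size)
    generalize boundary (eraseObj o.name R) (sizeClass o.size) = b at *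
    -- The hole without a record is in a class at least b if it is in a payload, so the invariant
    -- holds on the first b regions.
    have h1 := h.erase ho hbound
    refine ⟨?_, h1.flushed horder hspec⟩
    have hused : ∀ r ∈ eraseObj o.name R, r.used ≤ r.capacity ε := by
      intro r hr
      obtain ⟨i, hi⟩ := List.mem_iff_getElem?.1 hr
      obtain ⟨r₀, h0, rfl⟩ := getElem?_eraseObj hi
      rw [capacity_erase, Region.used, slotsSize_erase]
      exact h.used_le_of_mem (List.mem_of_getElem? h0)
    intro m hm
    rcases List.mem_cons.1 hm with rfl | hm
    · exact h.bounded hε hε'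
    · refine flush_bounded hε hε' horder h1 hspec (volume_sublist List.filter_sublist)
        (by simpa using hused) ?_ ?_ ?_ ?_ m hm
      · exact List.sum_le_sum fun r hr => hused r (List.mem_of_mem_drop hr)
      · rw [space_eraseObj, map_capacity_eraseObj]
        simpa using h.space_add_le hε hε'
      · rw [map_capacity_eraseObj]
        exact h.capacity_le hε hε'
      · rw [space_eraseObj]
        exact hold
  · obtain ⟨hcj, hfit⟩ := findBuffer_some hf
    have h1 := h.erase_append_record ho hcj hfit
    have hlen : R.length = (appendToBuffer j (.record o) (eraseObj o.name R)).length := by simp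
    rw [hlen] at h1
    refine ⟨?_, h1⟩
    simp only [List.mem_cons, List.not_mem_nil, or_false]
    rintro m (rfl | rfl)
    · exact h.bounded hε hε'
    · refine h1.bounded_of_le_space hε hε' fun y hy => ?_
      rcases List.mem_append.1 hy with hy | hy
      · exact h1.layout_endpoint_le hy
      · rw [space_appendToBuffer, space_eraseObj]
        exact hold y hy

theorem process_spec {ε : ℝ} (hε : 0 < ε) (hε' : ε ≤ 1 / 2) {order : List Obj → List Obj}
    (horder : ∀ l, (order l).Perm l) {A : List Obj} {R : State} (h : Inv ε R.length A R)
    {q : Request} (hq : q.Admissible A) :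
    (∀ m ∈ (process ε order R A q).1, m.Bounded ε) ∧
      Inv ε (process ε order R A q).2.length (activeStep A q) (process ε order R A q).2 := by
  cases q with
  | insert n w => exact insertObj_spec hε hε' horder h hq.1 hq.2
  | delete n =>
    simp only [process]
    rcases hf : A.find? (fun o => o.name = n) with _ | o
    · obtain ⟨o, ho, hn⟩ := hq
      simpa [hn] using List.find?_eq_none.1 hf o ho
    · have hn : o.name = n := by simpa using List.find?_some hf
      subst hn
      rw [hf]
      exact deleteObj_spec hε hε' horder h (List.mem_of_find?_eq_some hf)

theorem execution_bounded {ε : ℝ} (hε : 0 < ε) (hε' : ε ≤ 1 / 2)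
    {order : List Obj → List Obj} (horder : ∀ l, (order l).Perm l) {requests : List Request}
    {A : List Obj} {R : State} (h : Inv ε R.length A R) (hreq : Admissible A requests) :
    ∀ m ∈ execution ε order R A requests, m.Bounded ε := by
  induction requests generalizing A R with
  | nil => simp [execution]
  | cons q qs ih =>
    obtain ⟨h1, h2⟩ := process_spec hε hε' horder h hreq.1
    intro m hm
    rcases List.mem_append.1 hm with hm | hm
    · exact h1 m hm
    · exact ih h2 hreq.2 m hm

end Realloc

theorem mainTheorem3 :
    ∃ C : ℝ, 0 < C ∧
      ∀ ε : ℝ, 0 < ε → ε ≤ 1 / 2 →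
      ∀ order : List Realloc.Obj → List Realloc.Obj, (∀ l, (order l).Perm l) →
      ∀ requests : List Realloc.Request, Realloc.Admissible [] requests →
      ∀ m ∈ Realloc.execution ε order [] [] requests,
        (m.footprint : ℝ) ≤
          (1 + C * ε) * (Realloc.volume m.active : ℝ) + (Realloc.longest m.active : ℝ) :=
  ⟨8, by norm_num, fun ε hε hε' _ horder _ hreq =>
    Realloc.execution_bounded hε hε' horder (Realloc.inv_nil ε) hreq⟩
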